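/- **Setting.** Let $E=\mathbb R^d$, let $C_l(E)$ be the space of bounded continuous real functions on $E$ with a limit at infinity, and let $b:\mathbb R^d\to\mathbb R^d$, $e:\mathbb R^d\to\mathbb R^{d\times d}$, $c:\mathbb R^d\to\mathbb R^{d\times m}$ be Borel measurable. Let $\gamma_n,\gamma\in C_l(E)$ and $\sigma_n,\sigma\in C_l(E)$ with $\sigma_n,\sigma\ge 0$, and suppose $\gamma_n\to\gamma$ and $\sigma_n\to\sigma$ uniformly on $E$. For each $n\ge 1$ let a probability space carry the following branching particle system. There are $K_n$ (deterministic) initial particles at points $x^n_1,\dots,x^n_{K_n}\in E$. Labels are the multi-indices $\alpha=(\alpha_0,\dots,\alpha_k)$ of positive integers with $\alpha_0\le K_n$; write $|\alpha|=k$, and for $k\ge 1$ let $\alpha-1=(\alpha_0,\dots,\alpha_{k-1})$ be the parent of $\alpha$. There are an $\mathbb R^m$-valued Brownian motion $W^n$ and, independent of it, a family of $d$-dimensional Brownian motions $B^{\alpha,n}$, stopped at time $(|\alpha|+1)/n$, such that for each $k$ the $B^{\alpha,n}$ with $|\alpha|=k$ are conditionally independent given $\sigma\{B^{\alpha,n}:|\alpha|<k\}$,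 and $B^{\alpha,n}_t=B^{\alpha-1,n}_t$ for $t\le|\alpha|/n$. The process $Y^{\alpha,n}$ solves, on $[0,(|\alpha|+1)/n]$, $$dY^{\alpha,n}_t=b(Y^{\alpha,n}_t)\,dt+e(Y^{\alpha,n}_t)\,dB^{\alpha,n}_t+c(Y^{\alpha,n}_t)\,dW^n_t,\qquad Y^{\alpha,n}_0=x^n_{\alpha_0}.$$ The particle $\alpha$, if it is born, lives during $[|\alpha|/n,(|\alpha|+1)/n)$, moves along $Y^{\alpha,n}$ and leaves $N^{\alpha,n}\in\{0,1,2,\dots\}$ offspring at its death: each $\alpha$ with $|\alpha|=0$ is born, and $\alpha$ with $|\alpha|\ge1$ is born if and only if $\alpha-1$ is born and $\alpha_{|\alpha|}\le N^{\alpha-1,n}$. For $t\in[k/n,(k+1)/n)$ put $$\mathcal F^n_t=\sigma(B^{\alpha,n},N^{\alpha,n}:|\alpha|<k)\vee\bigcap_{r>t}\sigma(W^n_s,B^{\alpha,n}_s:s\le r,|\alpha|=k),$$ $$\bar{\mathcal F}^n_{k/n}=\mathcal F^n_{k/n}\vee\sigma(W^n_s,B^{\alpha,n}_s:s\le (k+1)/n,|\alpha|=k).$$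 For each $k$ the square integrable variables $N^{\alpha,n}$, $|\alpha|=k$, are conditionally independent given $\bar{\mathcal F}^n_{k/n}$, with $$\mathbb E(N^{\alpha,n}\mid\bar{\mathcal F}^n_{k/n})=1+\tfrac1n\gamma_n(Y^{\alpha,n}_{(k+1)/n}),\qquad \mathrm{Var}(N^{\alpha,n}\mid\bar{\mathcal F}^n_{k/n})=\sigma_n(Y^{\alpha,n}_{(k+1)/n})^2 .$$ Let $X^n_t(A)=\frac1n\#\{\text{particles in }A\text{ at time }t\}$ for Borel $A\subset E$, so that $X^n_t(1)=X^n_t(E)$ is the total mass and $X^n_0=\frac1n\sum_{i=1}^{K_n}\delta_{x^n_i}$. Suppose that there are $p>2$ and $C<\infty$ with $\mathbb E[(N^{\alpha,n})^p]\le C$ for all $\alpha$ and $n$. **Lemma 2.1.** Suppose that $X^n_0$ converges weakly to a finite Borel measure $\nu$ on $E$, and let $T\ge0$. Then $$C_T=\sup_{n\ge1}\mathbb E\Big(\sup_{0\le t\le T}X^n_t(1)^2\Big)<\infty .$$ If the moment bound holds for the particles that are born, that is, $$\mathbb E\big[(N^{\alpha,n})^p;\ \alpha\text{ is born}\big]\le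 C\,\mathbb P(\alpha\text{ is born})\quad\text{for all }\alpha\text{ and }n,$$ then also $$C'_T=\sup_{n\ge1}\mathbb E\Big(\sup_{0\le t\le T}X^n_t(1)^p\Big)<\infty .$$ -/

import Mathlib

open MeasureTheory ProbabilityTheory Filter Topology
open scoped NNReal ENNReal

namespace FlowBranching

/-- The space `ℝ^d` with its Euclidean norm. -/
abbrev E (d : ℕ) := EuclideanSpace ℝ (Fin d)

/-- `f ∈ C_l(ℝ^d)`: bounded, continuous, with a (finite) limit at infinity. -/
def InCl {d : ℕ} (f : E d → ℝ) : Prop :=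
  Continuous f ∧ (∃ M : ℝ, ∀ x, |f x| ≤ M) ∧ ∃ L : ℝ, Tendsto f (cocompact (E d)) (𝓝 L)

section Noise

variable {Ω : Type*} {mΩ : MeasurableSpace Ω}

/-- `B` is a standard `d`-dimensional Brownian motion started at `0`: its coordinates are
independent real Brownian motions. -/
def IsBrownian {d : ℕ} (B : ℝ≥0 → Ω → E d) (P : Measure Ω) : Prop :=
  (∀ i, IsBrownianReal (fun t ω => B t ω i) P) ∧
    iIndepFun (fun (i : Fin d) (ω : Ω) (t : ℝ≥0) => B t ω i) P

/-- `B` is a `d`-dimensional Brownian motion stopped at the deterministic time `θ`. -/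
def IsStoppedBrownian {d : ℕ} (θ : ℝ≥0) (B : ℝ≥0 → Ω → E d) (P : Measure Ω) : Prop :=
  ∃ β : ℝ≥0 → Ω → E d, IsBrownian β P ∧ ∀ᵐ ω ∂P, ∀ t, B t ω = β (min t θ) ω

/-- The `σ`-algebras `m i` are conditionally independent given the `σ`-algebra `G`. (Same as
`ProbabilityTheory.iCondIndep`, which Mathlib only defines on standard Borel spaces.) -/
def CondIndepFamily {ι : Type*} (P : Measure Ω) (G : MeasurableSpace Ω)
    (m : ι → MeasurableSpace Ω) : Prop :=
  ∀ (s : Finset ι) (A : ι → Set Ω), (∀ i ∈ s, MeasurableSet[m i] (A i)) →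
    P⟦⋂ i ∈ s, A i | G⟧ =ᵐ[P] ∏ i ∈ s, P⟦A i | G⟧

/-- A simple integrand for the filtration `H`: the process
`∑_{i < r} ξ_i 1_{(t_i, t_{i+1}]}` with `ξ_i` bounded and `H_{t_i}`-measurable. -/
structure SimpleIntegrand (H : Filtration ℝ≥0 mΩ) where
  r : ℕ
  t : ℕ → ℝ≥0
  t_mono : Monotone t
  ξ : ℕ → Ω → ℝ
  ξ_meas : ∀ i, Measurable[H (t i)] (ξ i)
  ξ_bdd : ∃ M : ℝ, ∀ i ω, |ξ i ω| ≤ M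

/-- The value at time `s` of a simple integrand. -/
noncomputable def SimpleIntegrand.val {H : Filtration ℝ≥0 mΩ} (S : SimpleIntegrand H)
    (s : ℝ≥0) (ω : Ω) : ℝ :=
  ∑ i ∈ Finset.range S.r, (Set.Ioc (S.t i) (S.t (i + 1))).indicator (fun _ => S.ξ i ω) s

/-- The elementary stochastic integral `∫_0^u S dβ`. -/
noncomputable def SimpleIntegrand.integral {H : Filtration ℝ≥0 mΩ} (S : SimpleIntegrand H)
    (β : ℝ≥0 → Ω → ℝ) (u : ℝ≥0) (ω : Ω) : ℝ :=
  ∑ i ∈ Finset.range S.r, S.ξ i ω * (β (min u (S.t (i + 1))) ω - β (min u (S.t i)) ω)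

/-- `I` is (a version of) the Itô integral `∫_0^u h_s dβ_s` of `h` against the real
`H`-Brownian motion `β`: there are simple integrands `S_k` with `∫_0^u |S_k - h|² ds → 0` in
probability and `∫_0^u S_k dβ → I` in probability. -/
def IsItoIntegral (P : Measure Ω) (H : Filtration ℝ≥0 mΩ) (β : ℝ≥0 → Ω → ℝ) (u : ℝ≥0)
    (h : ℝ≥0 → Ω → ℝ) (I : Ω → ℝ) : Prop :=
  ∃ S : ℕ → SimpleIntegrand H,
    (∀ ε : ℝ≥0∞, 0 < ε → Tendsto (fun k => P {ω | ε ≤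
      ∫⁻ s in Set.Ioc (0 : ℝ) u, ‖(S k).val s.toNNReal ω - h s.toNNReal ω‖ₑ ^ 2})
      atTop (𝓝 0)) ∧
    TendstoInMeasure P (fun k => (S k).integral β u) atTop I

/-- On the time interval `[0, θ]` the process `Y` is a continuous solution, driven by the
Brownian motions `B` and `W`, of
`dY_t = b(Y_t) dt + e(Y_t) dB_t + c(Y_t) dW_t`, `Y_0 = x₀`.
The filtration `H` is one for which `(B, W)` is an `H`-Brownian motion and `Y` is adapted. -/
def IsSDESolution {d m : ℕ} (P : Measure Ω) (b : E d → E d)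
    (e : E d → Matrix (Fin d) (Fin d) ℝ) (c : E d → Matrix (Fin d) (Fin m) ℝ)
    (x₀ : E d) (θ : ℝ≥0) (B : ℝ≥0 → Ω → E d) (W : ℝ≥0 → Ω → E m) (Y : ℝ≥0 → Ω → E d) : Prop :=
  ∃ H : Filtration ℝ≥0 mΩ,
    (∀ t ≤ θ, Measurable[H t] (B t) ∧ Measurable[H t] (W t) ∧ Measurable[H t] (Y t)) ∧
    (∀ s t, s ≤ t → t ≤ θ → Indep
      (MeasurableSpace.comap (fun ω => (B t ω - B s ω, W t ω - W s ω)) inferInstance) (H s) P) ∧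
    (∀ᵐ ω ∂P, Y 0 ω = x₀ ∧ ContinuousOn (fun t => Y t ω) (Set.Iic θ)) ∧
    ∃ (J : Fin d → Fin d → ℝ≥0 → Ω → ℝ) (L : Fin d → Fin m → ℝ≥0 → Ω → ℝ),
      (∀ t ≤ θ, ∀ i j, IsItoIntegral P H (fun s ω => B s ω j) t
        (fun s ω => e (Y s ω) i j) (J i j t)) ∧
      (∀ t ≤ θ, ∀ i l, IsItoIntegral P H (fun s ω => W s ω l) t
        (fun s ω => c (Y s ω) i l) (L i l t)) ∧
      ∀ t ≤ θ, ∀ i, ∀ᵐ ω ∂P,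
        IntegrableOn (fun s : ℝ => b (Y s.toNNReal ω) i) (Set.Ioc 0 (t : ℝ)) ∧
        Y t ω i = x₀ i + (∫ s in Set.Ioc 0 (t : ℝ), b (Y s.toNNReal ω) i)
          + ∑ j, J i j t ω + ∑ l, L i l t ω

end Noise

/-- Labels of generation `k`: multi-indices `α = (α_0, …, α_k)` of positive integers, of length
`|α| = k`, descending from one of the `K` initial particles, that is, with `α_0 ≤ K`. -/
def Label (K k : ℕ) : Type := {α : Fin (k + 1) → ℕ+ // (α 0 : ℕ) ≤ K}

/-- The label `α - 1` of the parent of `α`: the last entry is dropped. -/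
def Label.parent {K k : ℕ} (α : Label K (k + 1)) : Label K k :=
  ⟨Fin.init α.1, α.2⟩

/-- The data of the `n`-th particle system. `B`, `N`, `Y` are the individual noise, the number of
offspring and the motion of the particle with a given label; `W` is the common noise; the initial
particles are located at `x 1, …, x K`. -/
structure ParticleSystem (d m : ℕ) (Ω : Type*) where
  K : ℕ
  x : ℕ → E d
  W : ℝ≥0 → Ω → E m
  B : (k : ℕ) → Label K k → ℝ≥0 → Ω → E d
  N : (k : ℕ) → Label K k → Ω → ℕ
  Y : (k : ℕ) → Label K k → ℝ≥0 → Ω → E d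

namespace ParticleSystem

variable {d m : ℕ} {Ω : Type*} (S : ParticleSystem d m Ω)

/-- The particle `α` is really born (rather than being a virtual label): all its ancestors are,
and at each birth its rank among the siblings does not exceed the number of offspring. -/
def IsBorn : (k : ℕ) → Label S.K k → Ω → Prop
  | 0, _, _ => True
  | k + 1, α, ω => IsBorn k α.parent ω ∧ (α.1 (Fin.last (k + 1)) : ℕ) ≤ S.N k α.parent ω

/-- The measure `X^n_t`: each particle present at time `t` carries mass `1/n`. A particle of
generation `k` lives during `[k/n, (k+1)/n)`, so those present at time `t` are the particles of
generation `k = ⌊nt⌋` that are born. -/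
noncomputable def X (n : ℕ) (t : ℝ≥0) (ω : Ω) : Measure (E d) :=
  (n : ℝ≥0∞)⁻¹ • Measure.sum
    (fun α : {α : Label S.K ⌊(n : ℝ≥0) * t⌋₊ // S.IsBorn _ α ω} =>
      Measure.dirac (S.Y _ α.1 t ω))

/-- The deterministic initial measure `X^n_0 = (1/n) ∑_{i ≤ K} δ_{x_i}`. -/
noncomputable def X₀ (n : ℕ) : FiniteMeasure (E d) :=
  (n : ℝ≥0)⁻¹ • ∑ i ∈ Finset.Icc 1 S.K, ⟨Measure.dirac (S.x i), inferInstance⟩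

/-- `σ(B^α)`, the `σ`-algebra generated by the whole path of `B^α`. -/
@[reducible] def sigmaB (k : ℕ) (α : Label S.K k) : MeasurableSpace Ω :=
  ⨆ t : ℝ≥0, MeasurableSpace.comap (S.B k α t) inferInstance

/-- `σ(N^α)`. -/
@[reducible] def sigmaN (k : ℕ) (α : Label S.K k) : MeasurableSpace Ω :=
  MeasurableSpace.comap (S.N k α) inferInstance

/-- `σ(W)`, the `σ`-algebra generated by the whole path of `W`. -/
@[reducible] def sigmaW : MeasurableSpace Ω := ⨆ t : ℝ≥0, MeasurableSpace.comap (S.W t) inferInstance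

/-- `σ(W_s, B^α_s : s ≤ r, |α| = k)`. -/
@[reducible] def sigmaNoise (k : ℕ) (r : ℝ≥0) : MeasurableSpace Ω :=
  ⨆ s : ℝ≥0, ⨆ _ : s ≤ r, (MeasurableSpace.comap (S.W s) inferInstance ⊔
    ⨆ α : Label S.K k, MeasurableSpace.comap (S.B k α s) inferInstance)

/-- The `σ`-algebra `ℱ^n_t` for `t ∈ [k/n, (k+1)/n)`, namely
`σ(B^α, N^α : |α| < k) ∨ ⋂_{r > t} σ(W_s, B^α_s : s ≤ r, |α| = k)`. -/
@[reducible] def filt (k : ℕ) (t : ℝ≥0) : MeasurableSpace Ω :=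
  (⨆ j : ℕ, ⨆ _ : j < k, ⨆ α : Label S.K j, (S.sigmaB j α ⊔ S.sigmaN j α)) ⊔
    ⨅ r : ℝ≥0, ⨅ _ : t < r, S.sigmaNoise k r

/-- The `σ`-algebra `ℱ̄^n_{k/n} = ℱ^n_{k/n} ∨ σ(W_s, B^α_s : s ≤ (k+1)/n, |α| = k)`, the
information available just before the particles of generation `k` branch. -/
@[reducible] noncomputable def filtBar (n k : ℕ) : MeasurableSpace Ω :=
  S.filt k ((k : ℝ≥0) / n) ⊔ S.sigmaNoise k (((k : ℝ≥0) + 1) / n)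

/-- `S` is the `n`-th branching particle system with coefficients `b`, `e`, `c`, offspring mean
`1 + γ/n` and offspring variance `σ²` (evaluated at the place of branching). -/
structure IsBranchingSystem {mΩ : MeasurableSpace Ω} (P : Measure Ω) (n : ℕ) (b : E d → E d)
    (e : E d → Matrix (Fin d) (Fin d) ℝ) (c : E d → Matrix (Fin d) (Fin m) ℝ)
    (γ σ : E d → ℝ) : Prop where
  measurable_W : ∀ t, Measurable (S.W t)
  measurable_B : ∀ k α t, Measurable (S.B k α t)
  measurable_N : ∀ k α, Measurable (S.N k α)
  /-- `W` is a Brownian motion. -/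
  brownian_W : IsBrownian S.W P
  /-- `B^α` is a Brownian motion stopped at the end of the life of `α`. -/
  brownian_B : ∀ (k : ℕ) (α : Label S.K k), IsStoppedBrownian (((k : ℝ≥0) + 1) / n) (S.B k α) P
  /-- `W` is independent of the family of all `B^α`. -/
  indep_W_B : Indep S.sigmaW (⨆ k, ⨆ α, S.sigmaB k α) P
  /-- The `B^α`, `|α| = k`, are conditionally independent given those of earlier generations. -/
  condIndep_B : ∀ k, CondIndepFamily P (⨆ j : ℕ, ⨆ _ : j < k, ⨆ α : Label S.K j, S.sigmaB j α)
    (S.sigmaB k)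
  /-- Before the birth of a particle its noise is that of its parent. -/
  B_parent : ∀ (k : ℕ) (α : Label S.K (k + 1)), ∀ᵐ ω ∂P, ∀ t : ℝ≥0, t ≤ ((k : ℝ≥0) + 1) / n →
    S.B (k + 1) α t ω = S.B k α.parent t ω
  /-- Motion of the particles, along the ancestral line from time `0` on. -/
  motion : ∀ (k : ℕ) (α : Label S.K k), IsSDESolution P b e c (S.x (α.1 0)) (((k : ℝ≥0) + 1) / n)
    (S.B k α) S.W (S.Y k α)
  /-- The offspring numbers of generation `k` are conditionally independent given `ℱ̄`. -/
  condIndep_N : ∀ k, CondIndepFamily P (S.filtBar n k) (S.sigmaN k)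
  /-- The offspring numbers have finite second moments. -/
  memLp_N : ∀ k α, MemLp (fun ω => (S.N k α ω : ℝ)) 2 P
  /-- Conditional mean of the offspring numbers. -/
  mean_N : ∀ (k : ℕ) (α : Label S.K k), P[fun ω => (S.N k α ω : ℝ) | S.filtBar n k] =ᵐ[P]
    fun ω => 1 + γ (S.Y k α (((k : ℝ≥0) + 1) / n) ω) / n
  /-- Conditional variance of the offspring numbers. -/
  var_N : ∀ (k : ℕ) (α : Label S.K k), Var[fun ω => (S.N k α ω : ℝ); P | S.filtBar n k] =ᵐ[P]
    fun ω => σ (S.Y k α (((k : ℝ≥0) + 1) / n) ω) ^ 2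

end ParticleSystem

end FlowBranching

open FlowBranching

/-! Let Z_k be the number of particles of generation k. The total mass at time t is Z_k / n with k =
⌊nt⌋, so the motion matters only through the points where γ_n and σ_n are evaluated, and uniform
bounds |γ_n| ≤ g, |σ_n| ≤ s remove even that dependence. What remains is a moment estimate for a
nearly critical branching process over about nT generations, started from at most κn particles.

Fixed times. Conditionally on the past, Z_{k+1} is a sum of m = Z_k conditionally independent
offspring numbers N_i. They are replaced by 1 one at a time. With z the rest of the sum, a second
order bound for (z + N_i)^p has zeroth and first order terms z^p + p z^(p-1) E N_i, of which z^p + p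
z^(p-1) is at most (z + 1)^p by convexity. The errors are of order z^(p-1) / n from the drift,
z^(p-2) from the variance, and E N_i^p. After m replacements this gives E Z_{k+1}^p ≤ (1 + a/n) E
Z_k^p + b n^(p-1) (`lintegral_card_born_succ_le`), hence E Z_k^p ≤ c₁ n^p for k ≤ nT
(`le_mul_rpow_of_recursion`).

Supremum. The mean offspring number is at least 1 - g/n, so Z_k + (g/n) ∑_{j<k} Z_j is a
submartingale. It dominates Z_k and its p-th moments are of order n^p, so Doob's inequality
(`lintegral_partialSups_rpow_le`) concludes.

The terms E N_i^p are summed over the born particles only, which calls for E[N^p; born] ≤ C P(born).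
For exponent 2 this follows from the conditional mean and variance, because being born is an event
of the past; for exponent p it is the additional moment assumption. -/

namespace FlowBranching

/-! ### Convexity and Young-type inequalities for powers. -/

section Elementary

theorem rpow_eq_rpow_sub_one_mul {p x : ℝ} (hp : 1 ≤ p) (hx : 0 ≤ x) :
    x ^ p = x ^ (p - 1) * x := by
  rw [← Real.rpow_add_one' hx (by simp; linarith)]; simp

theorem nnreal_rpow_eq_rpow_sub_one_mul {p : ℝ} (hp : 1 ≤ p) (x : ℝ≥0) :
    x ^ p = x ^ (p - 1) * x := by
  rw [← NNReal.rpow_add_one' (by simp; linarith)]; simp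

/-- The graph of t ↦ t^p lies above its tangent at x: Bernoulli's inequality for y / x, multiplied
by x^p. The other tangent estimates come from this one. -/
theorem mul_rpow_sub_one_mul_le {p x y : ℝ} (hp : 1 ≤ p) (hx : 0 ≤ x) (hy : 0 ≤ y) :
    p * x ^ (p - 1) * y ≤ (p - 1) * x ^ p + y ^ p := by
  rcases hx.eq_or_lt with rfl | hx
  · rcases hp.eq_or_lt with rfl | hp
    · simp
    · rw [Real.zero_rpow (by linarith), Real.zero_rpow (by linarith)]
      simpa using Real.rpow_nonneg hy p
  · have h := one_add_mul_self_le_rpow_one_add (s := y / x - 1)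
      (by have := div_nonneg hy hx.le; linarith) hp
    have h1 : (1 + (y / x - 1)) ^ p * x ^ p = y ^ p := by
      rw [add_sub_cancel, ← Real.mul_rpow (by positivity) hx.le, div_mul_cancel₀ _ hx.ne']
    have h2 : x ^ p = x ^ (p - 1) * x := rpow_eq_rpow_sub_one_mul hp hx.le
    have h3 := mul_le_mul_of_nonneg_right h (Real.rpow_nonneg hx.le p)
    rw [h1] at h3
    have h4 : (1 + p * (y / x - 1)) * x ^ p = x ^ p + p * (x ^ (p - 1) * y) - p * x ^ p := by
      rw [h2]; field_simp; ring
    rw [h4] at h3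
    linarith

theorem add_rpow_le_tangent {p x y : ℝ} (hp : 1 ≤ p) (hx : 0 ≤ x) (hy : 0 ≤ y) :
    (x + y) ^ p ≤ x ^ p + p * (x + y) ^ (p - 1) * y := by
  have h := mul_rpow_sub_one_mul_le hp (add_nonneg hx hy) hx
  have h2 : (x + y) ^ p = (x + y) ^ (p - 1) * (x + y) :=
    rpow_eq_rpow_sub_one_mul hp (add_nonneg hx hy)
  rw [h2] at h ⊢
  linarith

theorem rpow_add_mul_rpow_sub_one_le {p : ℝ} (hp : 1 ≤ p) (x : ℝ≥0) :
    x ^ p + p.toNNReal * x ^ (p - 1) ≤ (x + 1) ^ p := by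
  have h := mul_rpow_sub_one_mul_le hp x.2 (add_nonneg x.2 zero_le_one)
  have h2 : (x : ℝ) ^ p = (x : ℝ) ^ (p - 1) * x :=
    rpow_eq_rpow_sub_one_mul hp x.coe_nonneg
  rw [← NNReal.coe_le_coe]
  push_cast
  rw [Real.coe_toNNReal _ (by linarith)]
  simp only [NNReal.val_eq_coe] at h
  have h5 : p * ((x : ℝ) ^ (p - 1) * x) = p * (x : ℝ) ^ p := by rw [← h2]
  nlinarith [h]

theorem add_rpow_le_two_rpow_mul {q : ℝ} (hq : 0 ≤ q) {x y : ℝ} (hx : 0 ≤ x) (hy : 0 ≤ y) :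
    (x + y) ^ q ≤ 2 ^ q * (x ^ q + y ^ q) := by
  have hx' := Real.rpow_nonneg hx q
  have hy' := Real.rpow_nonneg hy q
  rcases le_total x y with h | h
  · calc (x + y) ^ q ≤ (2 * y) ^ q := Real.rpow_le_rpow (by positivity) (by linarith) hq
      _ = 2 ^ q * y ^ q := Real.mul_rpow (by norm_num) hy
      _ ≤ _ := by gcongr; linarith
  · calc (x + y) ^ q ≤ (2 * x) ^ q := Real.rpow_le_rpow (by positivity) (by linarith) hq
      _ = 2 ^ q * x ^ q := Real.mul_rpow (by norm_num) hx
      _ ≤ _ := by gcongr; linarith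

/-- A second order upper bound for `(x + y) ^ p`. -/
theorem exists_add_rpow_le {p : ℝ} (hp : 2 ≤ p) : ∃ c : ℝ≥0, ∀ x y : ℝ≥0,
    (x + y) ^ p ≤ x ^ p + p.toNNReal * x ^ (p - 1) * y + c * (x ^ (p - 2) * y ^ 2 + y ^ p) := by
  -- The tangent bound is applied at exponent p and again at p - 1, leaving p (p - 1) (x + y)^(p-2)
  -- y²; splitting (x + y)^(p-2) costs the factor 2^(p-2).
  refine ⟨(p * (p - 1) * 2 ^ (p - 2)).toNNReal, fun x y => ?_⟩
  have hp1 : 0 ≤ p - 1 := by linarith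
  have hp0 : 0 ≤ p := by linarith
  rw [← NNReal.coe_le_coe]
  push_cast
  rw [Real.coe_toNNReal _ hp0, Real.coe_toNNReal _ (by positivity)]
  have hx : (0 : ℝ) ≤ x := x.2
  have hy : (0 : ℝ) ≤ y := y.2
  have h1 := add_rpow_le_tangent (p := p) (by linarith) hx hy
  have h2 := add_rpow_le_tangent (p := p - 1) (by linarith) hx hy
  rw [show p - 1 - 1 = p - 2 by ring] at h2
  have h3 := add_rpow_le_two_rpow_mul (q := p - 2) (by linarith) hx hy
  have h4 : (y : ℝ) ^ p = (y : ℝ) ^ (p - 2) * y ^ 2 := by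
    rw [← Real.rpow_natCast, ← Real.rpow_add' hy (by simp; linarith)]; simp
  rw [h4]
  calc _ ≤ (x : ℝ) ^ p + p * ((x : ℝ) ^ (p - 1) + (p - 1) *
        (2 ^ (p - 2) * ((x : ℝ) ^ (p - 2) + (y : ℝ) ^ (p - 2))) * y) * y := by
        refine h1.trans ?_
        gcongr
        refine h2.trans ?_
        gcongr
    _ = _ := by ring

/-- Young's inequality obtained by comparing x with 4y. The weight 1/4 is small enough for the power
of the running maximum to be absorbed in Doob's inequality. -/
theorem rpow_sub_one_mul_le {p : ℝ} (hp : 1 ≤ p) (x y : ℝ≥0) :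
    x ^ (p - 1) * y ≤ x ^ p / 4 + 4 ^ (p - 1) * y ^ p := by
  have key := nnreal_rpow_eq_rpow_sub_one_mul hp
  rcases le_total (4 * y) x with h | h
  · calc x ^ (p - 1) * y ≤ x ^ (p - 1) * (x / 4) := by
          gcongr; rw [le_div_iff₀ (by norm_num)]; rwa [mul_comm]
      _ = x ^ p / 4 := by rw [key x, mul_div_assoc]
      _ ≤ _ := le_self_add
  · calc x ^ (p - 1) * y ≤ (4 * y) ^ (p - 1) * y := by gcongr
      _ = 4 ^ (p - 1) * y ^ p := by rw [key y, NNReal.mul_rpow, mul_assoc]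
      _ ≤ _ := le_add_self

/-- Trades a lower power for the full power with a small factor 1/m, by splitting at x = m. The
level m will be the current population size or n. -/
theorem rpow_sub_one_le {p : ℝ} (hp : 1 ≤ p) (x : ℝ≥0) {m : ℝ≥0} (hm : m ≠ 0) :
    x ^ (p - 1) ≤ x ^ p / m + m ^ (p - 1) := by
  rcases le_total x m with h | h
  · exact (NNReal.rpow_le_rpow h (by linarith)).trans le_add_self
  · refine le_trans ?_ le_self_add
    rw [le_div_iff₀ (pos_iff_ne_zero.2 hm)]
    calc x ^ (p - 1) * m ≤ x ^ (p - 1) * x := by gcongr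
      _ = x ^ p := (nnreal_rpow_eq_rpow_sub_one_mul hp x).symm

theorem rpow_sub_two_le {p : ℝ} (hp : 2 ≤ p) (x : ℝ≥0) {m : ℝ≥0} (hm : m ≠ 0) :
    x ^ (p - 2) ≤ x ^ p / m ^ 2 + m ^ (p - 2) := by
  rcases le_total x m with h | h
  · exact (NNReal.rpow_le_rpow h (by linarith)).trans le_add_self
  · refine le_trans ?_ le_self_add
    rw [le_div_iff₀ (by positivity)]
    calc x ^ (p - 2) * m ^ 2 ≤ x ^ (p - 2) * x ^ 2 := by gcongr
      _ = x ^ p := by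
        rw [← NNReal.rpow_natCast, ← NNReal.rpow_add' (by simp; linarith)]; simp

end Elementary

/-! ### Doob's maximal inequality from a pathwise inequality. -/

section Maximal

/-- Pathwise form of Doob's `L^p` inequality. -/
theorem pathwise_maximal {p : ℝ} (hp : 1 ≤ p) (s : ℕ → ℝ≥0) (k : ℕ) :
    p * ∑ j ∈ Finset.range k, (partialSups s j : ℝ) ^ (p - 1) * s (j + 1)
        + (p - 1) * (partialSups s k : ℝ) ^ p ≤
      p * ∑ j ∈ Finset.range k, (partialSups s j : ℝ) ^ (p - 1) * s j
        + p * (partialSups s k : ℝ) ^ (p - 1) * s k := by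
  induction k with
  | zero =>
    have h2 : (s 0 : ℝ) ^ p = (s 0 : ℝ) ^ (p - 1) * s 0 :=
      rpow_eq_rpow_sub_one_mul hp (s 0).coe_nonneg
    have := Real.rpow_nonneg (s 0).2 p
    simp only [NNReal.val_eq_coe] at this
    simp [partialSups_zero, mul_assoc, ← h2]
    linarith
  | succ k ih =>
    rw [Finset.sum_range_succ, Finset.sum_range_succ]
    -- If the maximum does not move, both sides agree. At a new maximum it equals s (k + 1), and the
    -- claim is the tangent inequality at the old maximum.
    have key : p * (partialSups s k : ℝ) ^ (p - 1) * s (k + 1)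
          + (p - 1) * (partialSups s (k + 1) : ℝ) ^ p ≤
        (p - 1) * (partialSups s k : ℝ) ^ p
          + p * (partialSups s (k + 1) : ℝ) ^ (p - 1) * s (k + 1) := by
      rw [← Order.succ_eq_add_one, partialSups_succ]
      rcases le_total (s (Order.succ k)) (partialSups s k) with h | h
      · rw [sup_eq_left.2 h]; linarith
      · rw [sup_eq_right.2 h]
        have h1 := mul_rpow_sub_one_mul_le hp (partialSups s k).2 (s (Order.succ k)).2
        have h2 := rpow_eq_rpow_sub_one_mul hp (s (Order.succ k)).coe_nonneg
        simp only [NNReal.val_eq_coe] at h1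
        have h3 : p * ((s (Order.succ k) : ℝ) ^ (p - 1) * s (Order.succ k)) =
            p * (s (Order.succ k) : ℝ) ^ p := by
          rw [h2]
        linarith
    linarith

/-- Young's inequality moves a quarter of the maximal term to the left. As (p - 1)/p ≥ 1/2 for p ≥
2, at least a quarter of it survives there; the factor 4 normalises it. The sums stay on separate
sides to avoid subtraction. -/
theorem pathwise_maximal_nnreal {p : ℝ} (hp : 2 ≤ p) (s : ℕ → ℝ≥0) (k : ℕ) :
    4 * ∑ j ∈ Finset.range k, partialSups s j ^ (p - 1) * s (j + 1)
        + partialSups s k ^ p ≤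
      4 * ∑ j ∈ Finset.range k, partialSups s j ^ (p - 1) * s j + 4 ^ (p + 1) * s k ^ p := by
  have h := pathwise_maximal (p := p) (by linarith) s k
  have h1 := rpow_sub_one_mul_le (p := p) (by linarith) (partialSups s k) (s k)
  rw [← NNReal.coe_le_coe] at h1 ⊢
  push_cast at h1 ⊢
  have hm : (0 : ℝ) ≤ (partialSups s k : ℝ) ^ p := Real.rpow_nonneg (partialSups s k).2 _
  have hs : (0 : ℝ) ≤ 4 ^ (p - 1) * (s k : ℝ) ^ p :=
    mul_nonneg (by positivity) (Real.rpow_nonneg (s k).2 _)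
  have e4 : (4 : ℝ) ^ (p + 1) = 16 * 4 ^ (p - 1) := by
    rw [show p + 1 = (p - 1) + 2 by ring, Real.rpow_add (by norm_num)]; norm_num; ring
  rw [e4]
  set A := ∑ j ∈ Finset.range k, (partialSups s j : ℝ) ^ (p - 1) * s (j + 1)
  set B := ∑ j ∈ Finset.range k, (partialSups s j : ℝ) ^ (p - 1) * s j
  have hp0 : 0 < p := by linarith
  have h2 : p * ((partialSups s k : ℝ) ^ (p - 1) * s k) ≤
      p * ((partialSups s k : ℝ) ^ p / 4 + 4 ^ (p - 1) * (s k : ℝ) ^ p) := by gcongr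
  refine le_of_mul_le_mul_left ?_ hp0
  nlinarith [mul_nonneg (show 0 ≤ p - 2 by linarith) hm]

/-- Doob's `L^p` inequality, for a nonnegative submartingale and `p ≥ 2`. -/
theorem lintegral_partialSups_rpow_le {Ω : Type*} {mΩ : MeasurableSpace Ω} {P : Measure Ω}
    {p : ℝ} (hp : 2 ≤ p) (G : ℕ → MeasurableSpace Ω) (hG : Monotone G) (hGm : ∀ k, G k ≤ mΩ)
    (s : ℕ → Ω → ℝ≥0) (hs : ∀ k, Measurable[G k] (s k))
    (hsub : ∀ k (f : Ω → ℝ≥0), Measurable[G k] f →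
      ∫⁻ ω, f ω * s k ω ∂P ≤ ∫⁻ ω, f ω * s (k + 1) ω ∂P)
    (k : ℕ) (hfin : ∀ j ≤ k, ∫⁻ ω, (s j ω : ℝ≥0∞) ^ p ∂P ≠ ∞) :
    ∫⁻ ω, (partialSups (fun j => s j ω) k : ℝ≥0∞) ^ p ∂P ≤
      4 ^ (p + 1) * ∫⁻ ω, (s k ω : ℝ≥0∞) ^ p ∂P := by
  have hp0 : 0 ≤ p := by linarith
  have hp1 : 0 ≤ p - 1 := by linarith
  have hmax : ∀ k, Measurable[G k] fun ω => partialSups (fun j => s j ω) k := by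
    intro k
    induction k with
    | zero => simpa using hs 0
    | succ k ih =>
      simp_rw [← Order.succ_eq_add_one, partialSups_succ]
      exact Measurable.sup (m := G (Order.succ k)) (ih.mono (hG (Nat.le_succ k)) le_rfl)
        (hs (k + 1))
  have hmax' : ∀ k, Measurable fun ω => partialSups (fun j => s j ω) k :=
    fun k => (hmax k).mono (hGm k) le_rfl
  have hs' : ∀ k, Measurable (s k) := fun k => (hs k).mono (hGm k) le_rfl
  have hle : ∀ k ω, partialSups (fun j => s j ω) k ≤ ∑ j ∈ Finset.range (k + 1), s j ω := by
    intro k ω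
    refine partialSups_le _ _ _ fun j hj => ?_
    exact Finset.single_le_sum (f := fun j => s j ω) (fun _ _ => zero_le)
      (Finset.mem_range.2 (Nat.lt_succ_of_le hj))
  have hmaxfin : ∀ j ≤ k, ∫⁻ ω, (partialSups (fun j => s j ω) j : ℝ≥0∞) ^ p ∂P ≠ ∞ := by
    intro j hj
    have : ∫⁻ ω, (partialSups (fun j => s j ω) j : ℝ≥0∞) ^ p ∂P ≤
        ∫⁻ ω, (((Finset.range (j + 1)).card : ℝ≥0∞) ^ (p - 1) *
          ∑ i ∈ Finset.range (j + 1), (s i ω : ℝ≥0∞) ^ p) ∂P := by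
      refine lintegral_mono fun ω => ?_
      refine le_trans ?_ (ENNReal.rpow_sum_le_const_mul_sum_rpow _ _ (by linarith))
      gcongr
      exact_mod_cast hle j ω
    refine ne_top_of_le_ne_top ?_ this
    rw [lintegral_const_mul', lintegral_finsetSum]
    · refine ENNReal.mul_ne_top (ENNReal.rpow_ne_top_of_nonneg hp1 (by simp)) ?_
      rw [ENNReal.sum_ne_top]
      intro i hi
      exact hfin i (by simp at hi; omega)
    · intro i _; exact (hs' i).coe_nnreal_ennreal.pow_const p
    · exact ENNReal.rpow_ne_top_of_nonneg hp1 (by simp)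
  have hA : ∀ j, Measurable fun ω => partialSups (fun j => s j ω) j ^ (p - 1) :=
    fun j => (hmax' j).pow_const _
  have hcoe : ∀ j ω, ((partialSups (fun j => s j ω) j ^ (p - 1) : ℝ≥0) : ℝ≥0∞) =
      (partialSups (fun j => s j ω) j : ℝ≥0∞) ^ (p - 1) :=
    fun j ω => ENNReal.coe_rpow_of_nonneg _ hp1
  have hB : ∀ j ∈ Finset.range k,
      ∫⁻ ω, ((partialSups (fun j => s j ω) j ^ (p - 1) : ℝ≥0) : ℝ≥0∞) * s j ω ∂P ≠ ∞ := by
    intro j hj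
    refine ne_top_of_le_ne_top (hmaxfin j (Finset.mem_range.1 hj).le) (lintegral_mono fun ω => ?_)
    rw [← ENNReal.coe_mul, ← ENNReal.coe_rpow_of_nonneg _ hp0]
    norm_cast
    rw [nnreal_rpow_eq_rpow_sub_one_mul (p := p) (by linarith)]
    gcongr
    exact le_partialSups (fun j => s j ω) j
  set A : ℝ≥0∞ := ∑ j ∈ Finset.range k,
    ∫⁻ ω, ((partialSups (fun j => s j ω) j ^ (p - 1) : ℝ≥0) : ℝ≥0∞) * s (j + 1) ω ∂P with hAdef
  set B : ℝ≥0∞ := ∑ j ∈ Finset.range k,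
    ∫⁻ ω, ((partialSups (fun j => s j ω) j ^ (p - 1) : ℝ≥0) : ℝ≥0∞) * s j ω ∂P with hBdef
  have hBA : B ≤ A := Finset.sum_le_sum fun j _ =>
    hsub j _ ((hmax j).pow_const _)
  have hBtop : B ≠ ∞ := ENNReal.sum_ne_top.2 hB
  have hint : 4 * A + ∫⁻ ω, (partialSups (fun j => s j ω) k : ℝ≥0∞) ^ p ∂P ≤
      4 * B + 4 ^ (p + 1) * ∫⁻ ω, (s k ω : ℝ≥0∞) ^ p ∂P := by
    rw [hAdef, hBdef, ← lintegral_finsetSum, ← lintegral_finsetSum, ← lintegral_const_mul',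
      ← lintegral_const_mul', ← lintegral_const_mul', ← lintegral_add_left, ← lintegral_add_left]
    · refine lintegral_mono fun ω => ?_
      have := ENNReal.coe_le_coe.2 (pathwise_maximal_nnreal hp (fun j => s j ω) k)
      push_cast at this
      rw [ENNReal.coe_rpow_of_nonneg _ hp0, ENNReal.coe_rpow_of_nonneg _ hp0,
        ENNReal.coe_rpow_of_nonneg _ (by linarith)] at this
      exact this
    · exact ((Finset.measurable_sum _ fun j _ =>
        ((hA j).coe_nnreal_ennreal.mul (hs' j).coe_nnreal_ennreal))).const_mul _
    · exact ((Finset.measurable_sum _ fun j _ =>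
        ((hA j).coe_nnreal_ennreal.mul (hs' (j + 1)).coe_nnreal_ennreal))).const_mul _
    · exact ENNReal.rpow_ne_top_of_nonneg (by linarith) (by simp)
    · simp
    · simp
    · intro j _; exact (hA j).coe_nnreal_ennreal.mul (hs' j).coe_nnreal_ennreal
    · intro j _; exact (hA j).coe_nnreal_ennreal.mul (hs' (j + 1)).coe_nnreal_ennreal
  -- The submartingale property gives B ≤ A, so A may be lowered to B and then cancelled. Only B has
  -- to be finite for this, which is where the moments of all s j with j ≤ k enter.
  have h4B : 4 * B ≠ ∞ := ENNReal.mul_ne_top (by simp) hBtop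
  refine (ENNReal.add_le_add_iff_left h4B).1 (le_trans ?_ hint)
  gcongr

end Maximal

/-! ### Conditional expectations tested against nonnegative functions of the past. -/

section Conditional

variable {Ω : Type*} {F mΩ : MeasurableSpace Ω} {P : Measure Ω}

/-- The measures with densities φ and its conditional expectation coincide on F, hence integrate
every F-measurable f alike. Since f takes values in [0, ∞], no integrability of the product is
needed. -/
theorem lintegral_mul_ofReal_condExp [IsFiniteMeasure P] (hF : F ≤ mΩ) {f : Ω → ℝ≥0∞}
    (hf : Measurable[F] f) {φ : Ω → ℝ} (hφ : Integrable φ P) (h0 : 0 ≤ φ) :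
    ∫⁻ ω, f ω * ENNReal.ofReal (φ ω) ∂P = ∫⁻ ω, f ω * ENNReal.ofReal ((P[φ | F]) ω) ∂P := by
  have hc : 0 ≤ᵐ[P] P[φ | F] := condExp_nonneg (Eventually.of_forall h0)
  have hm : (P.withDensity fun ω => ENNReal.ofReal (φ ω)).trim hF =
      (P.withDensity fun ω => ENNReal.ofReal ((P[φ | F]) ω)).trim hF := by
    refine @Measure.ext _ F _ _ fun A hA => ?_
    rw [trim_measurableSet_eq hF hA, trim_measurableSet_eq hF hA, withDensity_apply _ (hF A hA),
      withDensity_apply _ (hF A hA),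
      ← ofReal_integral_eq_lintegral_ofReal hφ.integrableOn (Eventually.of_forall h0),
      ← ofReal_integral_eq_lintegral_ofReal integrable_condExp.integrableOn
        (ae_restrict_of_ae hc), setIntegral_condExp hF hφ hA]
  have h1 := lintegral_trim (μ := P.withDensity fun ω => ENNReal.ofReal (φ ω)) hF hf
  rw [hm, lintegral_trim hF hf, lintegral_withDensity_eq_lintegral_mul₀
    (integrable_condExp.aemeasurable.ennreal_ofReal) (hf.mono hF le_rfl).aemeasurable,
    lintegral_withDensity_eq_lintegral_mul₀
    (hφ.aemeasurable.ennreal_ofReal) (hf.mono hF le_rfl).aemeasurable] at h1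
  simp only [Pi.mul_apply] at h1
  simp_rw [mul_comm (f _)]
  exact h1.symm

theorem lintegral_mul_ofReal_le_of_condExp_le [IsFiniteMeasure P] (hF : F ≤ mΩ) {f : Ω → ℝ≥0∞}
    (hf : Measurable[F] f) {φ : Ω → ℝ} (hφ : Integrable φ P) (h0 : 0 ≤ φ) {K : ℝ}
    (hK : ∀ᵐ ω ∂P, (P[φ | F]) ω ≤ K) :
    ∫⁻ ω, f ω * ENNReal.ofReal (φ ω) ∂P ≤ ENNReal.ofReal K * ∫⁻ ω, f ω ∂P := by
  rw [lintegral_mul_ofReal_condExp hF hf hφ h0, ← lintegral_const_mul' _ _ ENNReal.ofReal_ne_top]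
  refine lintegral_mono_ae (hK.mono fun ω h => ?_)
  rw [mul_comm]
  gcongr

theorem le_lintegral_mul_ofReal_of_le_condExp [IsFiniteMeasure P] (hF : F ≤ mΩ) {f : Ω → ℝ≥0∞}
    (hf : Measurable[F] f) {φ : Ω → ℝ} (hφ : Integrable φ P) (h0 : 0 ≤ φ) {K : ℝ}
    (hK : ∀ᵐ ω ∂P, K ≤ (P[φ | F]) ω) :
    ENNReal.ofReal K * ∫⁻ ω, f ω ∂P ≤ ∫⁻ ω, f ω * ENNReal.ofReal (φ ω) ∂P := by
  rw [lintegral_mul_ofReal_condExp hF hf hφ h0, ← lintegral_const_mul' _ _ ENNReal.ofReal_ne_top]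
  refine lintegral_mono_ae (hK.mono fun ω h => ?_)
  rw [mul_comm]
  gcongr

/-- Condition on F, factorise, and undo the conditioning for D alone. The event B is thereby
replaced by an F-measurable weight, while D remains an event. -/
theorem measure_inter_inter_eq_lintegral [IsFiniteMeasure P] (hF : F ≤ mΩ) {A B D : Set Ω}
    (hA : MeasurableSet[F] A) (hB : MeasurableSet B) (hD : MeasurableSet D)
    (h : P⟦B ∩ D | F⟧ =ᵐ[P] P⟦B | F⟧ * P⟦D | F⟧) :
    P (A ∩ B ∩ D) =
      ∫⁻ ω in A, ENNReal.ofReal ((P⟦B | F⟧) ω) * D.indicator 1 ω ∂P := by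
  have hi : ∀ E : Set Ω, MeasurableSet E → Integrable (E.indicator fun _ => (1 : ℝ)) P :=
    fun E hE => (integrable_const 1).indicator hE
  have h0 : ∀ E : Set Ω, 0 ≤ E.indicator fun _ => (1 : ℝ) :=
    fun E => Set.indicator_nonneg fun _ _ => zero_le_one
  have he : ∀ (E : Set Ω) ω, ENNReal.ofReal (E.indicator (fun _ => (1 : ℝ)) ω) =
      E.indicator 1 ω := by
    intro E ω; by_cases hω : ω ∈ E <;> simp [hω]
  have hAf : Measurable[F] (A.indicator (1 : Ω → ℝ≥0∞)) :=
    Measurable.indicator (@measurable_const _ _ _ F 1) hA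
  have hBf : Measurable[F] fun ω => A.indicator (1 : Ω → ℝ≥0∞) ω * ENNReal.ofReal ((P⟦B | F⟧) ω) :=
    hAf.mul stronglyMeasurable_condExp.measurable.ennreal_ofReal
  have hAm := hF A hA
  have e1 := lintegral_mul_ofReal_condExp hF hAf (hi _ (hB.inter hD)) (h0 _)
  have e2 := lintegral_mul_ofReal_condExp hF hBf (hi _ hD) (h0 _)
  simp_rw [he] at e1 e2
  have e3 : ∫⁻ ω, A.indicator (1 : Ω → ℝ≥0∞) ω * (B ∩ D).indicator 1 ω ∂P = P (A ∩ B ∩ D) := by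
    rw [← lintegral_indicator_one (hAm.inter hB |>.inter hD)]
    congr 1; ext ω
    by_cases h1 : ω ∈ A <;> by_cases h2 : ω ∈ B <;> by_cases h3 : ω ∈ D <;> simp [h1, h2, h3]
  rw [← e3, e1, ← lintegral_indicator hAm]
  have e4 : (fun ω => A.indicator (1 : Ω → ℝ≥0∞) ω * ENNReal.ofReal ((P⟦B ∩ D | F⟧) ω)) =ᵐ[P]
      fun ω => A.indicator (1 : Ω → ℝ≥0∞) ω * ENNReal.ofReal ((P⟦B | F⟧) ω)
        * ENNReal.ofReal ((P⟦D | F⟧) ω) := by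
    have hc : 0 ≤ᵐ[P] P⟦B | F⟧ := condExp_nonneg (Eventually.of_forall (h0 _))
    filter_upwards [h, hc] with ω h1 h2
    rw [h1, Pi.mul_apply, ENNReal.ofReal_mul h2, mul_assoc]
  rw [lintegral_congr_ae e4, ← e2]
  congr 1; ext ω
  by_cases hω : ω ∈ A <;> simp [hω]

/-- Averaging out one of several conditionally independent integer valued variables. -/
theorem CondIndepFamily.setLIntegral_mul_le [IsFiniteMeasure P] (hF : F ≤ mΩ) {ι : Type*}
    [DecidableEq ι] {N : ι → Ω → ℕ} (hN : ∀ i, Measurable (N i))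
    (hci : CondIndepFamily P F fun i => MeasurableSpace.comap (N i) inferInstance)
    {i : ι} {s : Finset ι} (hi : i ∉ s) {A : Set Ω} (hA : MeasurableSet[F] A)
    (φ : ℕ → ℝ≥0∞) {K : ℝ≥0∞}
    (hK : ∀ f : Ω → ℝ≥0∞, Measurable[F] f → ∫⁻ ω, f ω * φ (N i ω) ∂P ≤ K * ∫⁻ ω, f ω ∂P)
    (g : (s → ℕ) → ℝ≥0∞) :
    ∫⁻ ω in A, g (fun j => N j ω) * φ (N i ω) ∂P ≤ K * ∫⁻ ω in A, g (fun j => N j ω) ∂P := by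
  have hAm := hF A hA
  set Z : Ω → s → ℕ := fun ω j => N j ω with hZ
  have hZm : Measurable Z := measurable_pi_lambda _ fun j => hN j
  have hB : ∀ v : s → ℕ, MeasurableSet (Z ⁻¹' {v}) := fun v => hZm (measurableSet_singleton v)
  have hD : ∀ k : ℕ, MeasurableSet (N i ⁻¹' {k}) := fun k => hN i (measurableSet_singleton k)
  -- Conditional independence is used for s and for `insert i s`, with v extended by the value k at
  -- i; comparing the two products isolates the factor of `N i`.
  have hprod : ∀ (v : s → ℕ) (k : ℕ),
      P⟦Z ⁻¹' {v} ∩ N i ⁻¹' {k} | F⟧ =ᵐ[P] P⟦Z ⁻¹' {v} | F⟧ * P⟦N i ⁻¹' {k} | F⟧ := by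
    intro v k
    let w : ι → ℕ := fun j => if h : j ∈ s then v ⟨j, h⟩ else k
    have hw : w i = k := by simp [w, hi]
    have hms : ∀ j, MeasurableSet[MeasurableSpace.comap (N j) inferInstance] (N j ⁻¹' {w j}) :=
      fun j => ⟨{w j}, measurableSet_singleton _, rfl⟩
    have hs1 := hci s (fun j => N j ⁻¹' {w j}) fun j _ => hms j
    have hs2 := hci (insert i s) (fun j => N j ⁻¹' {w j}) fun j _ => hms j
    have hsB : (⋂ j ∈ s, N j ⁻¹' {w j}) = Z ⁻¹' {v} := by
      ext ω
      simp only [Set.mem_iInter, Set.mem_preimage, Set.mem_singleton_iff, hZ, funext_iff,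
        Subtype.forall]
      refine forall₂_congr fun j hj => ?_
      simp [w, hj]
    rw [hsB] at hs1
    rw [Finset.prod_insert hi, Finset.set_biInter_insert, hsB, hw, Set.inter_comm] at hs2
    filter_upwards [hs1, hs2] with ω h1 h2
    rw [h2, Pi.mul_apply, Pi.mul_apply, ← h1, mul_comm]
  -- On a level set of Z, its indicator is exchanged for its conditional probability h. Then 1_A h
  -- is an admissible test function in `hK`.
  have key : ∀ v : s → ℕ, ∫⁻ ω in A ∩ Z ⁻¹' {v}, φ (N i ω) ∂P ≤ K * P (A ∩ Z ⁻¹' {v}) := by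
    intro v
    set h : Ω → ℝ≥0∞ := fun ω => ENNReal.ofReal ((P⟦Z ⁻¹' {v} | F⟧) ω) with hh
    have hhm : Measurable[F] h := stronglyMeasurable_condExp.measurable.ennreal_ofReal
    have hφ : ∀ ω, φ (N i ω) = ∑' k, φ k * (N i ⁻¹' {k}).indicator (1 : Ω → ℝ≥0∞) ω := by
      intro ω
      rw [tsum_eq_single (N i ω)]
      · simp
      · intro k hk
        simp [hk.symm]
    have hmi : ∀ k, Measurable ((N i ⁻¹' {k}).indicator (1 : Ω → ℝ≥0∞)) :=
      fun k => measurable_one.indicator (hD k)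
    have hmh : ∀ k, Measurable fun ω => h ω * (N i ⁻¹' {k}).indicator (1 : Ω → ℝ≥0∞) ω :=
      fun k => (hhm.mono hF le_rfl).mul (hmi k)
    have hl : ∫⁻ ω in A ∩ Z ⁻¹' {v}, φ (N i ω) ∂P = ∫⁻ ω in A, h ω * φ (N i ω) ∂P := by
      simp_rw [hφ, ← ENNReal.tsum_mul_left, mul_left_comm (h _)]
      rw [lintegral_tsum fun k => ((hmi k).const_mul _).aemeasurable, 
        lintegral_tsum fun k => ((hmh k).const_mul _).aemeasurable]
      refine tsum_congr fun k => ?_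
      rw [lintegral_const_mul _ (hmi k), lintegral_const_mul _ (hmh k),
        ← measure_inter_inter_eq_lintegral hF hA (hB v) (hD k) (hprod v k),
        lintegral_indicator_one (hD k), Measure.restrict_apply (hD k), Set.inter_comm]
    have hr : ∫⁻ ω in A, h ω ∂P = P (A ∩ Z ⁻¹' {v}) := by
      have := lintegral_mul_ofReal_condExp (P := P) hF
        (Measurable.indicator (@measurable_const ℝ≥0∞ _ _ F 1) hA)
        ((integrable_const (1 : ℝ)).indicator (hB v))
        (Set.indicator_nonneg fun _ _ => zero_le_one)
      rw [← lintegral_indicator_one (hAm.inter (hB v)), ← lintegral_indicator hAm]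
      convert this.symm using 2
      · ext ω; by_cases hω : ω ∈ A <;> simp [hω, hh]
      · ext ω
        by_cases hω : ω ∈ A <;> by_cases hω' : ω ∈ Z ⁻¹' {v} <;> simp [hω, hω']
    have := hK (A.indicator h) (hhm.indicator hA)
    rw [lintegral_indicator hAm, hr] at this
    rw [hl, ← lintegral_indicator hAm]
    convert this using 2
    ext ω; by_cases hω : ω ∈ A <;> simp [hω]
  have hU : A = ⋃ v, A ∩ Z ⁻¹' {v} := by
    rw [← Set.inter_iUnion]; ext ω; simp
  have hdisj : Pairwise (Function.onFun Disjoint fun v => A ∩ Z ⁻¹' {v}) := by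
    intro v w hvw
    refine Disjoint.mono Set.inter_subset_right Set.inter_subset_right ?_
    exact Disjoint.preimage _ (by simpa using hvw)
  have hms := fun v => hAm.inter (hB v)
  rw [hU, lintegral_iUnion hms hdisj, lintegral_iUnion hms hdisj, ← ENNReal.tsum_mul_left]
  refine ENNReal.tsum_le_tsum fun v => ?_
  have c1 : ∫⁻ ω in A ∩ Z ⁻¹' {v}, g (Z ω) * φ (N i ω) ∂P =
      g v * ∫⁻ ω in A ∩ Z ⁻¹' {v}, φ (N i ω) ∂P := by
    rw [← lintegral_const_mul (f := fun ω => φ (N i ω)) _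
      ((measurable_from_top (f := φ)).comp (hN i))]
    refine setLIntegral_congr_fun (hms v) fun ω hω => ?_
    rw [show Z ω = v from hω.2]
  have c2 : ∫⁻ ω in A ∩ Z ⁻¹' {v}, g (Z ω) ∂P = g v * P (A ∩ Z ⁻¹' {v}) := by
    rw [← setLIntegral_const]
    refine setLIntegral_congr_fun (hms v) fun ω hω => ?_
    rw [show Z ω = v from hω.2]
  rw [c1, c2, mul_left_comm]
  gcongr
  exact key v

end Conditional

/-! ### Moment growth in one generation, by replacing offspring numbers by 1. -/

section Generation

variable {Ω : Type*} {F mΩ : MeasurableSpace Ω} {P : Measure Ω} {ι : Type*} {N : ι → Ω → ℕ}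

/-- The part z^p + p z^(p-1) is absorbed in (z + 1)^p with constant exactly 1, so only the drift δ
and the second moment bound v produce errors. The level m makes these small relative to (z + 1)^p.
-/
theorem one_particle_bound {p : ℝ} (hp : 2 ≤ p) (δ v c : ℝ≥0) {m : ℝ≥0} (hm : m ≠ 0) (z : ℝ≥0) :
    z ^ p + (1 + δ) * (p.toNNReal * z ^ (p - 1)) + v * (c * z ^ (p - 2)) ≤
      (1 + (p.toNNReal * δ / m + c * v / m ^ 2)) * (z + 1) ^ p
        + (p.toNNReal * δ * m ^ (p - 1) + c * v * m ^ (p - 2)) := by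
  have h0 := rpow_add_mul_rpow_sub_one_le (p := p) (by linarith) z
  have h1 : z ^ (p - 1) ≤ (z + 1) ^ p / m + m ^ (p - 1) :=
    (NNReal.rpow_le_rpow (le_self_add) (by linarith)).trans
      (rpow_sub_one_le (by linarith) (z + 1) hm)
  have h2 : z ^ (p - 2) ≤ (z + 1) ^ p / m ^ 2 + m ^ (p - 2) :=
    (NNReal.rpow_le_rpow (le_self_add) (by linarith)).trans (rpow_sub_two_le hp (z + 1) hm)
  calc _ = (z ^ p + p.toNNReal * z ^ (p - 1)) + p.toNNReal * δ * z ^ (p - 1)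
        + c * v * z ^ (p - 2) := by ring
    _ ≤ (z + 1) ^ p + p.toNNReal * δ * ((z + 1) ^ p / m + m ^ (p - 1))
        + c * v * ((z + 1) ^ p / m ^ 2 + m ^ (p - 2)) := by gcongr
    _ = _ := by ring

/-- A single replacement: the second order bound is applied to z + N i, where z contains the other
offspring numbers, and the powers of N i are averaged out with z held fixed. -/
theorem setLIntegral_insert_rpow_le [DecidableEq ι] [IsFiniteMeasure P] (hF : F ≤ mΩ)
    (hN : ∀ i, Measurable (N i))
    (hci : CondIndepFamily P F fun i => MeasurableSpace.comap (N i) inferInstance)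
    {δ v c : ℝ≥0} {p : ℝ} (hp : 2 ≤ p)
    (hc : ∀ x y : ℝ≥0, (x + y) ^ p ≤
      x ^ p + p.toNNReal * x ^ (p - 1) * y + c * (x ^ (p - 2) * y ^ 2 + y ^ p))
    (h1 : ∀ i, ∀ f : Ω → ℝ≥0∞, Measurable[F] f →
      ∫⁻ ω, f ω * N i ω ∂P ≤ (1 + δ) * ∫⁻ ω, f ω ∂P)
    (h2 : ∀ i, ∀ f : Ω → ℝ≥0∞, Measurable[F] f →
      ∫⁻ ω, f ω * (N i ω : ℝ≥0∞) ^ 2 ∂P ≤ v * ∫⁻ ω, f ω ∂P)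
    {A : Set Ω} (hA : MeasurableSet[F] A) {m : ℝ≥0} (hm : m ≠ 0) {i : ι} {s : Finset ι}
    (hi : i ∉ s) (r : ℕ) :
    ∫⁻ ω in A, (((r + ∑ j ∈ insert i s, N j ω : ℕ) : ℝ≥0) ^ p : ℝ≥0) ∂P ≤
      (1 + (p.toNNReal * δ / m + c * v / m ^ 2) : ℝ≥0) *
        ∫⁻ ω in A, (((r + 1 + ∑ j ∈ s, N j ω : ℕ) : ℝ≥0) ^ p : ℝ≥0) ∂P
      + (p.toNNReal * δ * m ^ (p - 1) + c * v * m ^ (p - 2) : ℝ≥0) * P A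
      + c * ∫⁻ ω in A, ((N i ω : ℝ≥0) ^ p : ℝ≥0) ∂P := by
  set z : Ω → ℝ≥0 := fun ω => ((r + ∑ j ∈ s, N j ω : ℕ) : ℝ≥0) with hz
  have hNm : ∀ j, Measurable fun ω => (N j ω : ℝ≥0) := fun j =>
    (measurable_from_top (f := fun k : ℕ => (k : ℝ≥0))).comp (hN j)
  have hzm : Measurable z := by
    simp only [hz, Nat.cast_add, Nat.cast_sum]
    exact (Finset.measurable_sum _ fun j _ => hNm j).const_add _
  have hzs : ∀ ω, z ω = ((r + ∑ j : s, N j ω : ℕ) : ℝ≥0) := by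
    intro ω; simp only [hz]; rw [← Finset.sum_coe_sort]
  have m1 : ∫⁻ ω in A, ((p.toNNReal * z ω ^ (p - 1) : ℝ≥0) : ℝ≥0∞) * N i ω ∂P ≤
      (1 + δ) * ∫⁻ ω in A, ((p.toNNReal * z ω ^ (p - 1) : ℝ≥0) : ℝ≥0∞) ∂P := by
    simp_rw [hzs]
    exact hci.setLIntegral_mul_le hF hN hi hA (fun k => (k : ℝ≥0∞)) (h1 i)
      (fun u => ((p.toNNReal * ((r + ∑ j : s, u j : ℕ) : ℝ≥0) ^ (p - 1) : ℝ≥0) : ℝ≥0∞))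
  have m2 : ∫⁻ ω in A, ((c * z ω ^ (p - 2) : ℝ≥0) : ℝ≥0∞) * (N i ω : ℝ≥0∞) ^ 2 ∂P ≤
      v * ∫⁻ ω in A, ((c * z ω ^ (p - 2) : ℝ≥0) : ℝ≥0∞) ∂P := by
    simp_rw [hzs]
    exact hci.setLIntegral_mul_le hF hN hi hA (fun k => (k : ℝ≥0∞) ^ 2) (h2 i)
      (fun u => ((c * ((r + ∑ j : s, u j : ℕ) : ℝ≥0) ^ (p - 2) : ℝ≥0) : ℝ≥0∞))
  have mz0 : Measurable fun ω => ((z ω ^ p : ℝ≥0) : ℝ≥0∞) := (hzm.pow_const _).coe_nnreal_ennreal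
  have mz1 : Measurable fun ω => ((p.toNNReal * z ω ^ (p - 1) : ℝ≥0) : ℝ≥0∞) :=
    ((hzm.pow_const _).const_mul _).coe_nnreal_ennreal
  have mz2 : Measurable fun ω => ((c * z ω ^ (p - 2) : ℝ≥0) : ℝ≥0∞) :=
    ((hzm.pow_const _).const_mul _).coe_nnreal_ennreal
  have mN : Measurable fun ω => (N i ω : ℝ≥0∞) := by
    simpa using (hNm i).coe_nnreal_ennreal
  have mNp : Measurable fun ω => (((N i ω : ℝ≥0) ^ p : ℝ≥0) : ℝ≥0∞) :=
    ((hNm i).pow_const _).coe_nnreal_ennreal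
  have mm1 : Measurable fun ω => ((p.toNNReal * z ω ^ (p - 1) : ℝ≥0) : ℝ≥0∞) * N i ω :=
    mz1.mul mN
  have mm2 : Measurable fun ω => ((c * z ω ^ (p - 2) : ℝ≥0) : ℝ≥0∞) * (N i ω : ℝ≥0∞) ^ 2 :=
    mz2.mul (mN.pow_const 2)
  have ma1 : Measurable fun ω => ((z ω ^ p : ℝ≥0) : ℝ≥0∞)
      + ((p.toNNReal * z ω ^ (p - 1) : ℝ≥0) : ℝ≥0∞) * N i ω := mz0.add mm1
  have ma2 : Measurable fun ω => ((z ω ^ p : ℝ≥0) : ℝ≥0∞)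
      + ((p.toNNReal * z ω ^ (p - 1) : ℝ≥0) : ℝ≥0∞) * N i ω
      + ((c * z ω ^ (p - 2) : ℝ≥0) : ℝ≥0∞) * (N i ω : ℝ≥0∞) ^ 2 := ma1.add mm2
  have ma3 : Measurable fun ω => ((z ω ^ p : ℝ≥0) : ℝ≥0∞)
      + (1 + δ) * ((p.toNNReal * z ω ^ (p - 1) : ℝ≥0) : ℝ≥0∞) := mz0.add (mz1.const_mul _)
  calc _ ≤ ∫⁻ ω in A, (((z ω ^ p : ℝ≥0) : ℝ≥0∞)
          + ((p.toNNReal * z ω ^ (p - 1) : ℝ≥0) : ℝ≥0∞) * N i ω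
          + ((c * z ω ^ (p - 2) : ℝ≥0) : ℝ≥0∞) * (N i ω : ℝ≥0∞) ^ 2
          + c * (((N i ω : ℝ≥0) ^ p : ℝ≥0) : ℝ≥0∞)) ∂P := by
        refine lintegral_mono fun ω => ?_
        have := hc (z ω) (N i ω)
        have e : ((r + ∑ j ∈ insert i s, N j ω : ℕ) : ℝ≥0) = z ω + N i ω := by
          simp only [hz, Finset.sum_insert hi]; push_cast; ring
        rw [e]
        have e2 : ∀ k : ℕ, (k : ℝ≥0∞) = ((k : ℝ≥0) : ℝ≥0∞) := fun k => by simp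
        simp only [e2]
        norm_cast
        push_cast
        refine this.trans (le_of_eq ?_)
        ring
    _ = ∫⁻ ω in A, ((z ω ^ p : ℝ≥0) : ℝ≥0∞) ∂P
          + ∫⁻ ω in A, ((p.toNNReal * z ω ^ (p - 1) : ℝ≥0) : ℝ≥0∞) * N i ω ∂P
          + ∫⁻ ω in A, ((c * z ω ^ (p - 2) : ℝ≥0) : ℝ≥0∞) * (N i ω : ℝ≥0∞) ^ 2 ∂P
          + c * ∫⁻ ω in A, (((N i ω : ℝ≥0) ^ p : ℝ≥0) : ℝ≥0∞) ∂P := by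
        rw [lintegral_add_left ma2, lintegral_add_left ma1, lintegral_add_left mz0,
          lintegral_const_mul _ mNp]
    _ ≤ ∫⁻ ω in A, ((z ω ^ p : ℝ≥0) : ℝ≥0∞) ∂P
          + (1 + δ) * ∫⁻ ω in A, ((p.toNNReal * z ω ^ (p - 1) : ℝ≥0) : ℝ≥0∞) ∂P
          + v * ∫⁻ ω in A, ((c * z ω ^ (p - 2) : ℝ≥0) : ℝ≥0∞) ∂P
          + c * ∫⁻ ω in A, (((N i ω : ℝ≥0) ^ p : ℝ≥0) : ℝ≥0∞) ∂P := by gcongr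
    _ = ∫⁻ ω in A, (((z ω ^ p : ℝ≥0) : ℝ≥0∞)
          + (1 + δ) * ((p.toNNReal * z ω ^ (p - 1) : ℝ≥0) : ℝ≥0∞)
          + v * ((c * z ω ^ (p - 2) : ℝ≥0) : ℝ≥0∞)) ∂P
          + c * ∫⁻ ω in A, (((N i ω : ℝ≥0) ^ p : ℝ≥0) : ℝ≥0∞) ∂P := by
        rw [lintegral_add_left ma3, lintegral_add_left mz0,
          lintegral_const_mul _ mz1, lintegral_const_mul _ mz2]
    _ ≤ ∫⁻ ω in A, ((1 + (p.toNNReal * δ / m + c * v / m ^ 2) : ℝ≥0) *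
          (((r + 1 + ∑ j ∈ s, N j ω : ℕ) : ℝ≥0) ^ p : ℝ≥0)
          + (p.toNNReal * δ * m ^ (p - 1) + c * v * m ^ (p - 2) : ℝ≥0)) ∂P
          + c * ∫⁻ ω in A, (((N i ω : ℝ≥0) ^ p : ℝ≥0) : ℝ≥0∞) ∂P := by
        refine add_le_add_left (lintegral_mono fun ω => ?_) _
        have e : ((r + 1 + ∑ j ∈ s, N j ω : ℕ) : ℝ≥0) = z ω + 1 := by
          simp only [hz]; push_cast; ring
        rw [e]
        have := ENNReal.coe_le_coe.2 (one_particle_bound hp δ v c hm (z ω))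
        simp only [ENNReal.coe_add, ENNReal.coe_mul, ENNReal.coe_one] at this ⊢
        exact this
    _ = _ := by
        rw [lintegral_add_right _ measurable_const, lintegral_const_mul' _ _ ENNReal.coe_ne_top,
          setLIntegral_const]

/-- Induction over the replacements; r counts the particles already replaced by 1, so r + |s| is
invariant. All additive errors are inflated by the full product of growth factors. -/
theorem setLIntegral_add_sum_rpow_le [DecidableEq ι] [IsFiniteMeasure P] (hF : F ≤ mΩ)
    (hN : ∀ i, Measurable (N i))
    (hci : CondIndepFamily P F fun i => MeasurableSpace.comap (N i) inferInstance)
    {δ v c : ℝ≥0} {p : ℝ} (hp : 2 ≤ p)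
    (hc : ∀ x y : ℝ≥0, (x + y) ^ p ≤
      x ^ p + p.toNNReal * x ^ (p - 1) * y + c * (x ^ (p - 2) * y ^ 2 + y ^ p))
    (h1 : ∀ i, ∀ f : Ω → ℝ≥0∞, Measurable[F] f →
      ∫⁻ ω, f ω * N i ω ∂P ≤ (1 + δ) * ∫⁻ ω, f ω ∂P)
    (h2 : ∀ i, ∀ f : Ω → ℝ≥0∞, Measurable[F] f →
      ∫⁻ ω, f ω * (N i ω : ℝ≥0∞) ^ 2 ∂P ≤ v * ∫⁻ ω, f ω ∂P)
    {A : Set Ω} (hA : MeasurableSet[F] A) {m : ℝ≥0} (hm : m ≠ 0) (s : Finset ι) (r : ℕ) :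
    ∫⁻ ω in A, (((r + ∑ j ∈ s, N j ω : ℕ) : ℝ≥0) ^ p : ℝ≥0) ∂P ≤
      ((1 + (p.toNNReal * δ / m + c * v / m ^ 2)) ^ s.card : ℝ≥0) *
        ((((r + s.card : ℕ) : ℝ≥0) ^ p : ℝ≥0) * P A
          + s.card * ((p.toNNReal * δ * m ^ (p - 1) + c * v * m ^ (p - 2) : ℝ≥0) * P A)
          + c * ∑ j ∈ s, ∫⁻ ω in A, ((N j ω : ℝ≥0) ^ p : ℝ≥0) ∂P) := by
  induction s using Finset.induction_on generalizing r with
  | empty => simp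
  | insert i s hi ih =>
    refine (setLIntegral_insert_rpow_le hF hN hci hp hc h1 h2 hA hm hi r).trans ?_
    have := ih (r + 1)
    rw [Finset.card_insert_of_notMem hi, Finset.sum_insert hi]
    set R : ℝ≥0 := 1 + (p.toNNReal * δ / m + c * v / m ^ 2)
    set κ : ℝ≥0∞ :=
      ((p.toNNReal * δ * m ^ (p - 1) + c * v * m ^ (p - 2) : ℝ≥0) : ℝ≥0∞) * P A
    have hR : (1 : ℝ≥0∞) ≤ (R ^ (s.card + 1) : ℝ≥0) := by
      rw [← ENNReal.coe_one, ENNReal.coe_le_coe]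
      exact one_le_pow₀ le_self_add
    set R' : ℝ≥0∞ := ((R ^ (s.card + 1) : ℝ≥0) : ℝ≥0∞) with hR'
    have hRR : (R : ℝ≥0∞) * (R ^ s.card : ℝ≥0) = R' := by
      rw [hR', ← ENNReal.coe_mul, pow_succ, mul_comm]
    set J : ℝ≥0∞ := ∫⁻ ω in A, ((N i ω : ℝ≥0) ^ p : ℝ≥0) ∂P
    set J' : ℝ≥0∞ := ∑ j ∈ s, ∫⁻ ω in A, ((N j ω : ℝ≥0) ^ p : ℝ≥0) ∂P
    have e : r + 1 + s.card = r + (s.card + 1) := by ring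
    rw [e] at this
    set Y : ℝ≥0∞ := ((((r + (s.card + 1) : ℕ) : ℝ≥0) ^ p : ℝ≥0) : ℝ≥0∞) * P A
    calc _ ≤ (R : ℝ≥0∞) * ((R ^ s.card : ℝ≥0) * (Y + s.card * κ + c * J')) + κ + c * J := by
          gcongr
      _ = R' * (Y + s.card * κ + c * J') + 1 * κ + 1 * (c * J) := by
          rw [← mul_assoc, hRR, one_mul, one_mul]
      _ ≤ R' * (Y + s.card * κ + c * J') + R' * κ + R' * (c * J) := by gcongr
      _ = _ := by push_cast; ring

theorem one_add_pow_le_of_mul_le {ρ x₀ : ℝ≥0} {m : ℕ} (h : m * ρ ≤ x₀) :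
    (1 + ρ) ^ m ≤ 1 + (Real.exp x₀).toNNReal * (m * ρ) ∧ (1 + ρ) ^ m ≤ (Real.exp x₀).toNNReal := by
  have h' : (m : ℝ) * ρ ≤ x₀ := by exact_mod_cast h
  have h0 : (0 : ℝ) ≤ m * ρ := by positivity
  have h1 : (1 + (ρ : ℝ)) ^ m ≤ Real.exp (m * ρ) := by
    rw [Real.exp_nat_mul]
    gcongr
    linarith [Real.add_one_le_exp (ρ : ℝ)]
  have h2 : Real.exp (m * ρ) ≤ Real.exp x₀ := Real.exp_le_exp.2 h'
  -- This is 1 - y ≤ exp (-y) multiplied by exp y.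
  have h3 : Real.exp (m * ρ) ≤ 1 + Real.exp (m * ρ) * (m * ρ) := by
    have := Real.add_one_le_exp (-((m : ℝ) * ρ))
    rw [Real.exp_neg] at this
    have hpos := Real.exp_pos ((m : ℝ) * ρ)
    have := mul_le_mul_of_nonneg_right this hpos.le
    rw [inv_mul_cancel₀ hpos.ne'] at this
    linarith
  constructor
  · rw [← NNReal.coe_le_coe]
    push_cast
    rw [Real.coe_toNNReal _ (Real.exp_pos _).le]
    refine h1.trans (h3.trans ?_)
    gcongr
  · rw [← NNReal.coe_le_coe]
    push_cast
    rw [Real.coe_toNNReal _ (Real.exp_pos _).le]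
    exact h1.trans h2

/-- Growth of the `p`-th moment of the population size in one generation, on an event `A` of the
past on which the present population is the finite set `s`. -/
theorem setLIntegral_sum_rpow_le [DecidableEq ι] [IsFiniteMeasure P] (hF : F ≤ mΩ)
    (hN : ∀ i, Measurable (N i))
    (hci : CondIndepFamily P F fun i => MeasurableSpace.comap (N i) inferInstance)
    {g v c D : ℝ≥0} {p : ℝ} (hp : 2 ≤ p) (hD : D = (Real.exp (p.toNNReal * g + c * v)).toNNReal)
    (hc : ∀ x y : ℝ≥0, (x + y) ^ p ≤
      x ^ p + p.toNNReal * x ^ (p - 1) * y + c * (x ^ (p - 2) * y ^ 2 + y ^ p))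
    {n : ℕ} (hn : 1 ≤ n)
    (h1 : ∀ i, ∀ f : Ω → ℝ≥0∞, Measurable[F] f →
      ∫⁻ ω, f ω * N i ω ∂P ≤ (1 + (g / n : ℝ≥0)) * ∫⁻ ω, f ω ∂P)
    (h2 : ∀ i, ∀ f : Ω → ℝ≥0∞, Measurable[F] f →
      ∫⁻ ω, f ω * (N i ω : ℝ≥0∞) ^ 2 ∂P ≤ v * ∫⁻ ω, f ω ∂P)
    {A : Set Ω} (hA : MeasurableSet[F] A) (s : Finset ι) :
    ∫⁻ ω in A, (((∑ j ∈ s, N j ω : ℕ) : ℝ≥0) ^ p : ℝ≥0) ∂P ≤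
      ((1 + 2 * D * (p.toNNReal * g + c * v) / n) * (s.card : ℝ≥0) ^ p : ℝ≥0) * P A
      + (2 * D * (c * v) * (n : ℝ≥0) ^ (p - 1) : ℝ≥0) * P A
      + (D * c : ℝ≥0) * ∑ j ∈ s, ∫⁻ ω in A, ((N j ω : ℝ≥0) ^ p : ℝ≥0) ∂P := by
  have hn0 : (n : ℝ≥0) ≠ 0 := by exact_mod_cast (by omega : n ≠ 0)
  have hn1 : (1 : ℝ≥0) ≤ n := by exact_mod_cast hn
  rcases s.eq_empty_or_nonempty with rfl | hs
  · simp [NNReal.zero_rpow (show p ≠ 0 by linarith)]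
  have hm0 : (s.card : ℝ≥0) ≠ 0 := by exact_mod_cast hs.card_pos.ne'
  have hm1 : (1 : ℝ≥0) ≤ s.card := by exact_mod_cast hs.card_pos
  -- The level is the population size m itself: then m replacements with rate ρ accumulate to m ρ =
  -- p g / n + c v / m, which is bounded, so the product of the growth factors is at most D.
  have h := setLIntegral_add_sum_rpow_le hF hN hci hp hc h1 h2 hA hm0 s 0
  simp only [Nat.zero_add] at h
  set m : ℝ≥0 := (s.card : ℝ≥0) with hm
  set q := p.toNNReal
  set ρ : ℝ≥0 := q * (g / n) / m + c * v / m ^ 2 with hρ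
  have hmρ : m * ρ = q * (g / n) + c * v / m := by rw [hρ]; field_simp
  have hgn : g / n ≤ g := div_le_self zero_le hn1
  have hx : s.card * ρ ≤ q * g + c * v := by
    rw [← hm, hmρ]; gcongr; exact div_le_self zero_le hm1
  obtain ⟨e1, e2⟩ := one_add_pow_le_of_mul_le hx
  push_cast at e1 e2
  rw [← hD] at e1 e2
  rw [← hm] at e1
  have hDone : 1 ≤ D := (one_le_pow₀ le_self_add).trans e2
  set κ : ℝ≥0 := q * (g / n) * m ^ (p - 1) + c * v * m ^ (p - 2) with hκ
  have mp1 : m ^ (p - 1) * m = m ^ p := (nnreal_rpow_eq_rpow_sub_one_mul (by linarith) m).symm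
  have mp2 : m ^ (p - 2) * m = m ^ (p - 1) := by
    rw [nnreal_rpow_eq_rpow_sub_one_mul (p := p - 1) (by linarith)]; ring_nf
  have hmκ : m * κ = q * (g / n) * m ^ p + c * v * m ^ (p - 1) := by
    rw [hκ, ← mp1, ← mp2]; ring
  have hmκ' : m * ρ * m ^ p = m * κ := by
    rw [hmρ, hmκ, add_mul, ← mp1]; field_simp
  have hmn : m ^ (p - 1) ≤ m ^ p / n + (n : ℝ≥0) ^ (p - 1) :=
    rpow_sub_one_le (by linarith) m hn0
  -- The growth factor and the additive errors contribute the same amount D m κ, whence the 2. The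
  -- variance part c v m^(p-1) becomes of relative order 1/n by splitting at level n.
  have hfin : (1 + ρ) ^ s.card * m ^ p + (1 + ρ) ^ s.card * (m * κ) ≤
      (1 + 2 * D * (q * g + c * v) / n) * m ^ p + 2 * D * (c * v) * (n : ℝ≥0) ^ (p - 1) := by
    calc _ ≤ (1 + D * (m * ρ)) * m ^ p + D * (m * κ) := by gcongr
      _ = m ^ p + 2 * D * (q * (g / n) * m ^ p + c * v * m ^ (p - 1)) := by
          rw [← hmκ, ← hmκ']; ring
      _ ≤ m ^ p + 2 * D * (q * (g / n) * m ^ p + c * v * (m ^ p / n + (n : ℝ≥0) ^ (p - 1))) := by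
          gcongr
      _ = _ := by ring
  calc _ ≤ _ := h
    _ = ((1 + ρ) ^ s.card * m ^ p + (1 + ρ) ^ s.card * (m * κ) : ℝ≥0) * P A
        + ((1 + ρ) ^ s.card * c : ℝ≥0) * ∑ j ∈ s, ∫⁻ ω in A, ((N j ω : ℝ≥0) ^ p : ℝ≥0) ∂P := by
        have : ((s.card : ℕ) : ℝ≥0∞) = (m : ℝ≥0∞) := by rw [hm]; simp
        rw [this]; push_cast; ring
    _ ≤ ((1 + 2 * D * (q * g + c * v) / n) * m ^ p + 2 * D * (c * v) * (n : ℝ≥0) ^ (p - 1) : ℝ≥0)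
          * P A + (D * c : ℝ≥0) * ∑ j ∈ s, ∫⁻ ω in A, ((N j ω : ℝ≥0) ^ p : ℝ≥0) ∂P := by
        gcongr
    _ = _ := by push_cast; ring

end Generation

/-! ### Genealogy: the set of born particles and its measurability. -/

instance Label.instCountable (K k : ℕ) : Countable (Label K k) := by
  unfold Label; infer_instance

/-- The child of rank `j` of the particle `α`. -/
def Label.child {K k : ℕ} (α : Label K k) (j : ℕ+) : Label K (k + 1) :=
  ⟨Fin.snoc (α := fun _ => ℕ+) α.1 j, by
    have : (0 : Fin (k + 1 + 1)) = (0 : Fin (k + 1)).castSucc := rfl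
    rw [this, Fin.snoc_castSucc]
    exact α.2⟩

theorem Label.parent_child {K k : ℕ} (α : Label K k) (j : ℕ+) : (α.child j).parent = α :=
  Subtype.ext (Fin.init_snoc (α := fun _ => ℕ+) j α.1)

theorem Label.child_last {K k : ℕ} (α : Label K k) (j : ℕ+) :
    (α.child j).1 (Fin.last (k + 1)) = j :=
  Fin.snoc_last (α := fun _ => ℕ+) j α.1

theorem Label.ext_parent {K k : ℕ} {α β : Label K (k + 1)} (h : α.parent = β.parent)
    (h' : α.1 (Fin.last (k + 1)) = β.1 (Fin.last (k + 1))) : α = β := by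
  apply Subtype.ext
  rw [← Fin.snoc_init_self α.1, ← Fin.snoc_init_self β.1, h']
  congr 1
  exact congrArg Subtype.val h

theorem Label.ext_zero {K : ℕ} {α β : Label K 0} (h : α.1 0 = β.1 0) : α = β := by
  apply Subtype.ext
  funext i
  rw [show i = 0 from Fin.fin_one_eq_zero i, h]

namespace ParticleSystem

variable {d m : ℕ} {Ω : Type*} (S : ParticleSystem d m Ω)

/-- There are infinitely many labels, but finitely many roots, and each born particle has finitely
many children. This holds for every ω, not only almost surely. -/
theorem finite_isBorn (k : ℕ) (ω : Ω) : {α : Label S.K k | S.IsBorn k α ω}.Finite := by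
  induction k with
  | zero =>
    refine Set.Finite.of_finite_image (f := fun α : Label S.K 0 => (α.1 0 : ℕ))
      ((Set.finite_Iic S.K).subset ?_) ?_
    · rintro _ ⟨α, -, rfl⟩; exact α.2
    · intro α _ β _ h; exact Label.ext_zero (PNat.coe_injective h)
  | succ k ih =>
    refine Set.Finite.subset (ih.biUnion (t := fun α => {β | β.parent = α ∧
      (β.1 (Fin.last (k + 1)) : ℕ) ≤ S.N k α ω}) fun α _ => ?_) ?_
    · refine Set.Finite.of_finite_image
        (f := fun β : Label S.K (k + 1) => (β.1 (Fin.last (k + 1)) : ℕ))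
        ((Set.finite_Iic (S.N k α ω)).subset ?_) ?_
      · rintro _ ⟨β, hβ, rfl⟩; exact hβ.2
      · intro β hβ β' hβ' h
        exact Label.ext_parent (hβ.1.trans hβ'.1.symm) (PNat.coe_injective h)
    · intro β hβ
      exact Set.mem_biUnion hβ.1 ⟨rfl, hβ.2⟩

/-- The set of the particles of generation `k` that are born. -/
noncomputable def born (k : ℕ) (ω : Ω) : Finset (Label S.K k) := (S.finite_isBorn k ω).toFinset

@[simp] theorem mem_born {k : ℕ} {ω : Ω} {α : Label S.K k} : α ∈ S.born k ω ↔ S.IsBorn k α ω := by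
  simp [born]

theorem card_born_zero_le (ω : Ω) : (S.born 0 ω).card ≤ S.K := by
  have : (S.born 0 ω).card ≤ (Finset.Icc 1 S.K).card := by
    refine Finset.card_le_card_of_injOn (fun α => (α.1 0 : ℕ)) (fun α _ => ?_) fun α _ β _ h =>
      Label.ext_zero (PNat.coe_injective h)
    exact Finset.mem_coe.2 (Finset.mem_Icc.2 ⟨(α.1 0).pos, α.2⟩)
  simpa using this

/-- The fibre of `Label.parent` over a born α is in bijection, through the last entry, with the
ranks 1, …, N. -/
theorem card_born_succ (k : ℕ) (ω : Ω) :
    (S.born (k + 1) ω).card = ∑ α ∈ S.born k ω, S.N k α ω := by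
  classical
  rw [Finset.card_eq_sum_card_fiberwise (f := Label.parent) (t := S.born k ω)]
  · refine Finset.sum_congr rfl fun α hα => ?_
    have : (Finset.Icc 1 (S.N k α ω)).card = S.N k α ω := by simp
    conv_rhs => rw [← this]
    refine Finset.card_bij (fun β _ => (β.1 (Fin.last (k + 1)) : ℕ)) ?_ ?_ ?_
    · intro β hβ
      obtain ⟨h1, rfl⟩ := Finset.mem_filter.1 hβ
      exact Finset.mem_Icc.2 ⟨(β.1 _).pos, (S.mem_born.1 h1).2⟩
    · intro β hβ β' hβ' h
      exact Label.ext_parent ((Finset.mem_filter.1 hβ).2.trans (Finset.mem_filter.1 hβ').2.symm)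
        (PNat.coe_injective h)
    · intro j hj
      obtain ⟨h1, h2⟩ := Finset.mem_Icc.1 hj
      obtain ⟨j, rfl⟩ : ∃ j' : ℕ+, (j' : ℕ) = j := ⟨⟨j, h1⟩, rfl⟩
      refine ⟨α.child j, Finset.mem_filter.2 ⟨S.mem_born.2 ⟨?_, ?_⟩, α.parent_child _⟩, ?_⟩
      · rw [Label.parent_child]; exact S.mem_born.1 hα
      · rw [Label.parent_child, Label.child_last]; exact h2
      · rw [Label.child_last]
  · intro β hβ
    exact Finset.mem_coe.2 (S.mem_born.2 (S.mem_born.1 (Finset.mem_coe.1 hβ)).1)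

theorem X_univ (n : ℕ) (t : ℝ≥0) (ω : Ω) :
    S.X n t ω Set.univ = (n : ℝ≥0∞)⁻¹ * ((S.born ⌊(n : ℝ≥0) * t⌋₊ ω).card : ℝ≥0∞) := by
  rw [X, Measure.smul_apply, Measure.sum_apply _ MeasurableSet.univ, smul_eq_mul]
  simp only [measure_univ, ENNReal.tsum_one]
  congr 1
  change ((ENat.card {α // α ∈ {α | S.IsBorn _ α ω}} : ℕ∞) : ℝ≥0∞) = _
  have := Set.encard_coe_eq_coe_finsetCard (S.born ⌊(n : ℝ≥0) * t⌋₊ ω)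
  rw [born, Set.Finite.coe_toFinset] at this
  rw [ENat.card_coe_set_eq, this]
  simp [born]

theorem sum_born_eq_tsum (k : ℕ) (ω : Ω) (f : Label S.K k → ℝ≥0∞) :
    ∑ α ∈ S.born k ω, f α = ∑' α, {ω | S.IsBorn k α ω}.indicator (fun _ => f α) ω := by
  rw [tsum_eq_sum (s := S.born k ω)]
  · refine Finset.sum_congr rfl fun α hα => ?_
    rw [Set.indicator_of_mem]; exact S.mem_born.1 hα
  · intro α hα
    rw [Set.indicator_of_notMem]
    exact fun h => hα (S.mem_born.2 h)

theorem card_born_eq_tsum (k : ℕ) (ω : Ω) :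
    ((S.born k ω).card : ℝ≥0∞) = ∑' α, {ω | S.IsBorn k α ω}.indicator (fun _ => 1) ω := by
  rw [← S.sum_born_eq_tsum k ω fun _ => 1]; simp

/-- The `σ`-algebra generated by the offspring numbers of the generations before `k`. -/
@[reducible] def offspringPast (k : ℕ) : MeasurableSpace Ω :=
  ⨆ j : ℕ, ⨆ _ : j < k, ⨆ α : Label S.K j, S.sigmaN j α

theorem offspringPast_mono : Monotone S.offspringPast := fun _ _ h =>
  iSup_mono fun _ => iSup_mono' fun hj => ⟨hj.trans_le h, le_rfl⟩

/-- The born set depends on earlier offspring numbers alone. This smaller σ-algebra serves as the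
filtration in Doob's inequality, and the inclusion lets its events act as test functions for the
conditional moments. -/
theorem offspringPast_le_filtBar (n k : ℕ) : S.offspringPast k ≤ S.filtBar n k :=
  le_trans (le_trans (iSup_mono fun _ => iSup_mono fun _ => iSup_mono fun _ => le_sup_right)
    le_sup_left) le_sup_left

theorem measurableSet_isBorn (k : ℕ) (α : Label S.K k) :
    MeasurableSet[S.offspringPast k] {ω | S.IsBorn k α ω} := by
  induction k with
  | zero => exact MeasurableSet.univ
  | succ k ih =>
    refine MeasurableSet.inter (s₁ := {ω | S.IsBorn k α.parent ω})
      (S.offspringPast_mono (Nat.le_succ k) _ (ih _)) ?_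
    have hle : S.sigmaN k α.parent ≤ S.offspringPast (k + 1) :=
      le_iSup_of_le k (le_iSup_of_le k.lt_succ_self (le_iSup (fun α => S.sigmaN k α) α.parent))
    exact hle _ ⟨Set.Ici (α.1 (Fin.last (k + 1)) : ℕ), trivial, rfl⟩

theorem measurableSet_born_eq (k : ℕ) (s : Finset (Label S.K k)) :
    MeasurableSet[S.offspringPast k] {ω | S.born k ω = s} := by
  have : {ω | S.born k ω = s} = ⋂ α, {ω | S.IsBorn k α ω ↔ α ∈ s} := by
    ext ω; simp [Finset.ext_iff]
  rw [this]
  refine MeasurableSet.iInter fun α => ?_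
  by_cases h : α ∈ s
  · simpa [h] using S.measurableSet_isBorn k α
  · simp only [h, iff_false]
    exact (S.measurableSet_isBorn k α).compl

theorem measurable_card_born (k : ℕ) :
    Measurable[S.offspringPast k] fun ω => ((S.born k ω).card : ℝ≥0) := by
  have h1 : @Measurable _ _ (S.offspringPast k) ⊤ (S.born k) :=
    @measurable_to_countable' _ _ ⊤ _ (S.offspringPast k) _ fun s => S.measurableSet_born_eq k s
  exact (@measurable_from_top _ _ _ (fun s : Finset (Label S.K k) => (s.card : ℝ≥0))).comp h1

variable {S} {mΩ : MeasurableSpace Ω} {P : Measure Ω} {n : ℕ} {b : E d → E d}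
    {e : E d → Matrix (Fin d) (Fin d) ℝ} {c : E d → Matrix (Fin d) (Fin m) ℝ} {γ σ : E d → ℝ}

/-! ### Conditional moment bounds for the offspring numbers. -/

theorem IsBranchingSystem.filtBar_le (hS : S.IsBranchingSystem P n b e c γ σ) (k : ℕ) :
    S.filtBar n k ≤ mΩ := by
  have hn : ∀ r, S.sigmaNoise k r ≤ mΩ := fun r =>
    iSup_le fun s => iSup_le fun _ => sup_le (hS.measurable_W s).comap_le
      (iSup_le fun α => (hS.measurable_B k α s).comap_le)
  refine sup_le (sup_le (iSup_le fun j => iSup_le fun _ => iSup_le fun α =>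
    sup_le (iSup_le fun t => (hS.measurable_B j α t).comap_le) (hS.measurable_N j α).comap_le) ?_)
    (hn _)
  exact iInf_le_of_le ((k : ℝ≥0) / n + 1)
    (iInf_le_of_le (lt_add_of_pos_right _ zero_lt_one) (hn _))

theorem IsBranchingSystem.offspringPast_le (hS : S.IsBranchingSystem P n b e c γ σ) (k : ℕ) :
    S.offspringPast k ≤ mΩ := (S.offspringPast_le_filtBar n k).trans (hS.filtBar_le k)

section

variable [IsProbabilityMeasure P] {g s : ℝ≥0}

theorem IsBranchingSystem.lintegral_mul_le (hS : S.IsBranchingSystem P n b e c γ σ)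
    (hg : ∀ x, |γ x| ≤ g) (k : ℕ) (α : Label S.K k) {f : Ω → ℝ≥0∞}
    (hf : Measurable[S.filtBar n k] f) :
    ∫⁻ ω, f ω * S.N k α ω ∂P ≤ (1 + (g / n : ℝ≥0)) * ∫⁻ ω, f ω ∂P := by
  have := lintegral_mul_ofReal_le_of_condExp_le (P := P) (hS.filtBar_le k) hf
    ((hS.memLp_N k α).integrable one_le_two) (fun ω => Nat.cast_nonneg _) (K := 1 + g / n) (by
      filter_upwards [hS.mean_N k α] with ω hω
      rw [hω]
      gcongr
      exact (abs_le.1 (hg _)).2)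
  simp only [ENNReal.ofReal_natCast] at this
  refine this.trans_eq ?_
  rw [ENNReal.ofReal_add zero_le_one (by positivity), ENNReal.ofReal_one]
  congr 2
  rw [show (g : ℝ) / n = ((g / n : ℝ≥0) : ℝ) by simp, ENNReal.ofReal_coe_nnreal]

/-- The lower bound 1 - g/n on the conditional mean, with g/n moved to the other side because 1 -
g/n may be negative. -/
theorem IsBranchingSystem.lintegral_le_mul_add (hS : S.IsBranchingSystem P n b e c γ σ)
    (hg : ∀ x, |γ x| ≤ g) (k : ℕ) (α : Label S.K k) {f : Ω → ℝ≥0∞}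
    (hf : Measurable[S.filtBar n k] f) :
    ∫⁻ ω, f ω ∂P ≤ ∫⁻ ω, f ω * S.N k α ω ∂P + (g / n : ℝ≥0) * ∫⁻ ω, f ω ∂P := by
  have := le_lintegral_mul_ofReal_of_le_condExp (P := P) (hS.filtBar_le k) hf
    ((hS.memLp_N k α).integrable one_le_two) (fun ω => Nat.cast_nonneg _) (K := 1 - g / n) (by
      filter_upwards [hS.mean_N k α] with ω hω
      rw [hω, sub_eq_add_neg, ← neg_div]
      gcongr
      exact (abs_le.1 (hg _)).1)
  simp only [ENNReal.ofReal_natCast] at this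
  refine le_trans ?_ (add_le_add_left this _)
  rw [← add_mul]
  nth_rw 1 [← one_mul (∫⁻ ω, f ω ∂P)]
  gcongr
  rw [← ENNReal.ofReal_coe_nnreal, ← ENNReal.ofReal_one]
  refine le_trans (ENNReal.ofReal_le_ofReal (le_of_eq ?_)) ENNReal.ofReal_add_le
  push_cast; ring

theorem IsBranchingSystem.lintegral_mul_sq_le (hS : S.IsBranchingSystem P n b e c γ σ)
    (hn : 1 ≤ n) (hg : ∀ x, |γ x| ≤ g) (hs : ∀ x, |σ x| ≤ s) (k : ℕ) (α : Label S.K k)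
    {f : Ω → ℝ≥0∞} (hf : Measurable[S.filtBar n k] f) :
    ∫⁻ ω, f ω * (S.N k α ω : ℝ≥0∞) ^ 2 ∂P ≤
      (s ^ 2 + (1 + g) ^ 2 : ℝ≥0) * ∫⁻ ω, f ω ∂P := by
  -- The conditional second moment is the variance plus the squared mean; n ≥ 1 bounds the mean by 1
  -- + g.
  have hv := condVar_ae_eq_condExp_sq_sub_sq_condExp (hS.filtBar_le k) (hS.memLp_N k α)
  have hn1 : (1 : ℝ) ≤ n := by exact_mod_cast hn
  have := lintegral_mul_ofReal_le_of_condExp_le (P := P) (hS.filtBar_le k) hf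
    (hS.memLp_N k α).integrable_sq (fun ω => sq_nonneg _) (K := s ^ 2 + (1 + g) ^ 2) (by
      filter_upwards [hv, hS.mean_N k α, hS.var_N k α] with ω h1 h2 h3
      simp only [Pi.sub_apply, Pi.pow_apply] at h1
      rw [h3, h2] at h1
      have e1 : σ (S.Y k α (((k : ℝ≥0) + 1) / n) ω) ^ 2 ≤ (s : ℝ) ^ 2 :=
        sq_le_sq' (abs_le.1 (hs _)).1 (abs_le.1 (hs _)).2
      have e2 : |γ (S.Y k α (((k : ℝ≥0) + 1) / n) ω) / n| ≤ g := by
        rw [abs_div, Nat.abs_cast]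
        exact (div_le_self (abs_nonneg _) hn1).trans (hg _)
      have e3 : (1 + γ (S.Y k α (((k : ℝ≥0) + 1) / n) ω) / n) ^ 2 ≤ (1 + (g : ℝ)) ^ 2 :=
        sq_le_sq' (by have := (abs_le.1 e2).1; linarith) (by have := (abs_le.1 e2).2; linarith)
      have h4 : (P[(fun ω => (S.N k α ω : ℝ)) ^ 2 | S.filtBar n k]) ω ≤
          (s : ℝ) ^ 2 + (1 + (g : ℝ)) ^ 2 := by linarith
      exact h4)
  have e0 : ∀ ω, ENNReal.ofReal ((S.N k α ω : ℝ) ^ 2) = (S.N k α ω : ℝ≥0∞) ^ 2 := fun ω => by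
    rw [ENNReal.ofReal_pow (Nat.cast_nonneg _), ENNReal.ofReal_natCast]
  simp only [e0] at this
  refine this.trans_eq ?_
  rw [show (s : ℝ) ^ 2 + (1 + (g : ℝ)) ^ 2 = ((s ^ 2 + (1 + g) ^ 2 : ℝ≥0) : ℝ) by simp,
    ENNReal.ofReal_coe_nnreal]

end

end ParticleSystem

/-! ### The moment recursion and the compensated population size. -/

namespace ParticleSystem

variable {d m : ℕ} {Ω : Type*} {S : ParticleSystem d m Ω} {mΩ : MeasurableSpace Ω} {P : Measure Ω}
  {n : ℕ} {b : E d → E d} {e : E d → Matrix (Fin d) (Fin d) ℝ}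
  {c : E d → Matrix (Fin d) (Fin m) ℝ} {γ σ : E d → ℝ}

/-- The born set is a random finite set of countably many labels, so it takes countably many values.
On each value the next generation is a sum over a deterministic index set. -/
theorem IsBranchingSystem.lintegral_eq_tsum_born (hS : S.IsBranchingSystem P n b e c γ σ)
    (k : ℕ) (h : Ω → ℝ≥0∞) :
    ∫⁻ ω, h ω ∂P = ∑' s, ∫⁻ ω in {ω | S.born k ω = s}, h ω ∂P := by
  classical
  rw [← lintegral_iUnion (fun s => hS.offspringPast_le k _ (S.measurableSet_born_eq k s)),
    ← setLIntegral_univ]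
  · congr 2; ext ω; simp
  · intro s t hst
    exact Set.disjoint_left.2 fun ω h1 h2 => hst (h1.symm.trans h2)

theorem coe_natCast_rpow {p : ℝ} (hp : 0 ≤ p) (k : ℕ) :
    (((k : ℝ≥0) ^ p : ℝ≥0) : ℝ≥0∞) = (k : ℝ≥0∞) ^ p := by
  rw [ENNReal.coe_rpow_of_nonneg _ hp]; simp

theorem IsBranchingSystem.measurable_coe_N (hS : S.IsBranchingSystem P n b e c γ σ) (k : ℕ)
    (α : Label S.K k) : Measurable fun ω => (S.N k α ω : ℝ≥0∞) :=
  (measurable_from_top (f := fun k : ℕ => (k : ℝ≥0∞))).comp (hS.measurable_N k α)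

/-- The sum over the random born set is a sum over all labels of integrals over the events of being
born. A moment bound relative to P(born) is what makes this infinite sum comparable with the mean
population size. -/
theorem IsBranchingSystem.lintegral_sum_born_rpow_le (hS : S.IsBranchingSystem P n b e c γ σ)
    {p : ℝ} {C : ℝ≥0} {k : ℕ}
    (hC : ∀ α, ∫⁻ ω in {ω | S.IsBorn k α ω}, (S.N k α ω : ℝ≥0∞) ^ p ∂P ≤
      C * P {ω | S.IsBorn k α ω}) :
    ∫⁻ ω, ∑ α ∈ S.born k ω, (S.N k α ω : ℝ≥0∞) ^ p ∂P ≤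
      C * ∫⁻ ω, ((S.born k ω).card : ℝ≥0∞) ∂P := by
  have hb : ∀ α : Label S.K k, MeasurableSet {ω | S.IsBorn k α ω} :=
    fun α => hS.offspringPast_le k _ (S.measurableSet_isBorn k α)
  simp_rw [card_born_eq_tsum]
  rw [lintegral_tsum fun α => (measurable_const.indicator (hb α)).aemeasurable,
    ← ENNReal.tsum_mul_left]
  have : ∀ ω, ∑ α ∈ S.born k ω, (S.N k α ω : ℝ≥0∞) ^ p =
      ∑' α, {ω | S.IsBorn k α ω}.indicator (fun ω => (S.N k α ω : ℝ≥0∞) ^ p) ω := fun ω => by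
    rw [S.sum_born_eq_tsum]
    exact tsum_congr fun α => by by_cases h : S.IsBorn k α ω <;> simp [h]
  simp_rw [this]
  rw [lintegral_tsum fun α =>
    (((hS.measurable_coe_N k α).pow_const p).indicator (hb α)).aemeasurable]
  refine ENNReal.tsum_le_tsum fun α => ?_
  rw [lintegral_indicator (hb α), lintegral_indicator (hb α)]
  simpa using hC α

variable [IsProbabilityMeasure P] {g s : ℝ≥0}

theorem IsBranchingSystem.lintegral_card_born_succ_le (hS : S.IsBranchingSystem P n b e c γ σ)
    (hn : 1 ≤ n) (hg : ∀ x, |γ x| ≤ g) (hs : ∀ x, |σ x| ≤ s) {p : ℝ} (hp : 2 ≤ p)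
    {v c₂ D C : ℝ≥0} (hv : v = s ^ 2 + (1 + g) ^ 2)
    (hD : D = (Real.exp (p.toNNReal * g + c₂ * v)).toNNReal)
    (hc : ∀ x y : ℝ≥0, (x + y) ^ p ≤
      x ^ p + p.toNNReal * x ^ (p - 1) * y + c₂ * (x ^ (p - 2) * y ^ 2 + y ^ p))
    {k : ℕ} (hC : ∀ α, ∫⁻ ω in {ω | S.IsBorn k α ω}, (S.N k α ω : ℝ≥0∞) ^ p ∂P ≤
      C * P {ω | S.IsBorn k α ω}) :
    ∫⁻ ω, ((S.born (k + 1) ω).card : ℝ≥0∞) ^ p ∂P ≤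
      (1 + (2 * D * (p.toNNReal * g + c₂ * v) + D * c₂ * C) / n : ℝ≥0) *
          ∫⁻ ω, ((S.born k ω).card : ℝ≥0∞) ^ p ∂P
        + ((2 * D * (c₂ * v) + D * c₂ * C) * (n : ℝ≥0) ^ (p - 1) : ℝ≥0) := by
  classical
  have hp0 : 0 ≤ p := by linarith
  have hn0 : (n : ℝ≥0) ≠ 0 := by exact_mod_cast (by omega : n ≠ 0)
  have hpast := hS.offspringPast_le k
  have hcard : Measurable fun ω => ((S.born k ω).card : ℝ≥0∞) := by
    simpa using ((S.measurable_card_born k).mono hpast le_rfl).coe_nnreal_ennreal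
  set a₀ : ℝ≥0 := 2 * D * (p.toNNReal * g + c₂ * v)
  set b₀ : ℝ≥0 := 2 * D * (c₂ * v)
  have hlocal : ∫⁻ ω, ((S.born (k + 1) ω).card : ℝ≥0∞) ^ p ∂P ≤
      ∫⁻ ω, ((1 + a₀ / n : ℝ≥0) * ((S.born k ω).card : ℝ≥0∞) ^ p
        + (b₀ * (n : ℝ≥0) ^ (p - 1) : ℝ≥0)
        + (D * c₂ : ℝ≥0) * ∑ α ∈ S.born k ω, (S.N k α ω : ℝ≥0∞) ^ p) ∂P := by
    rw [hS.lintegral_eq_tsum_born k, hS.lintegral_eq_tsum_born k (fun ω => _ + _ + _)]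
    refine ENNReal.tsum_le_tsum fun t => ?_
    have hA := S.measurableSet_born_eq k t
    have hA' := S.offspringPast_le_filtBar n k _ hA
    have h := setLIntegral_sum_rpow_le (hS.filtBar_le k) (hS.measurable_N k) (hS.condIndep_N k)
      hp hD hc hn (fun α f hf => hS.lintegral_mul_le hg k α hf)
      (fun α f hf => by rw [hv]; exact hS.lintegral_mul_sq_le hn hg hs k α hf) hA' t
    simp only [coe_natCast_rpow hp0, ENNReal.coe_mul _ ((t.card : ℝ≥0) ^ p)] at h
    have l1 : ∫⁻ ω in {ω | S.born k ω = t}, ((S.born (k + 1) ω).card : ℝ≥0∞) ^ p ∂P =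
        ∫⁻ ω in {ω | S.born k ω = t}, ((∑ j ∈ t, S.N k j ω : ℕ) : ℝ≥0∞) ^ p ∂P := by
      refine setLIntegral_congr_fun (hpast _ hA) fun ω hω => ?_
      rw [card_born_succ, show S.born k ω = t from hω]
    rw [l1]
    refine h.trans_eq ?_
    rw [← lintegral_finsetSum _ fun α _ => (hS.measurable_coe_N k α).pow_const p,
      ← lintegral_const_mul' _ _ ENNReal.coe_ne_top, ← setLIntegral_const, ← setLIntegral_const,
      ← lintegral_add_left measurable_const, ← lintegral_add_left measurable_const]
    refine setLIntegral_congr_fun (hpast _ hA) fun ω hω => ?_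
    rw [show S.born k ω = t from hω]
  -- The population size is an integer, hence at most its (p - 1)-th power, which is split at level
  -- n. This makes the offspring moments an error of relative order 1/n.
  have hcle : ∫⁻ ω, ((S.born k ω).card : ℝ≥0∞) ∂P ≤
      (n : ℝ≥0∞)⁻¹ * ∫⁻ ω, ((S.born k ω).card : ℝ≥0∞) ^ p ∂P
        + ((n : ℝ≥0) ^ (p - 1) : ℝ≥0) := by
    calc _ ≤ ∫⁻ ω, ((n : ℝ≥0∞)⁻¹ * ((S.born k ω).card : ℝ≥0∞) ^ p
          + ((n : ℝ≥0) ^ (p - 1) : ℝ≥0)) ∂P := by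
          refine lintegral_mono fun ω => ?_
          have h1 := rpow_sub_one_le (p := p) (by linarith) ((S.born k ω).card : ℝ≥0) hn0
          have h2 : ((S.born k ω).card : ℝ≥0) ≤ ((S.born k ω).card : ℝ≥0) ^ (p - 1) := by
            rcases Nat.eq_zero_or_pos (S.born k ω).card with h | h
            · simp [h]
            · conv_lhs => rw [← NNReal.rpow_one ((S.born k ω).card : ℝ≥0)]
              exact NNReal.rpow_le_rpow_of_exponent_le (by exact_mod_cast h) (by linarith)
          have h3 := ENNReal.coe_le_coe.2 (h2.trans h1)
          rw [ENNReal.coe_add, ENNReal.coe_div hn0, coe_natCast_rpow hp0] at h3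
          simpa [ENNReal.div_eq_inv_mul] using h3
      _ = _ := by
          rw [lintegral_add_right _ measurable_const, lintegral_const, measure_univ, mul_one,
            lintegral_const_mul _ (hcard.pow_const p)]
  refine hlocal.trans ?_
  have hm1 : Measurable fun ω => (1 + a₀ / n : ℝ≥0) * ((S.born k ω).card : ℝ≥0∞) ^ p
      + (b₀ * (n : ℝ≥0) ^ (p - 1) : ℝ≥0) :=
    ((hcard.pow_const p).const_mul _).add measurable_const
  rw [lintegral_add_left hm1,
    lintegral_add_right _ measurable_const, lintegral_const, measure_univ, mul_one,
    lintegral_const_mul _ (hcard.pow_const p), lintegral_const_mul' _ _ ENNReal.coe_ne_top]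
  set U := ∫⁻ ω, ((S.born k ω).card : ℝ≥0∞) ^ p ∂P
  calc _ ≤ (1 + a₀ / n : ℝ≥0) * U + (b₀ * (n : ℝ≥0) ^ (p - 1) : ℝ≥0)
        + (D * c₂ : ℝ≥0) * (C * ((n : ℝ≥0∞)⁻¹ * U + ((n : ℝ≥0) ^ (p - 1) : ℝ≥0))) := by
        gcongr
        exact (hS.lintegral_sum_born_rpow_le hC).trans (by gcongr)
    _ = _ := by
        have : (n : ℝ≥0∞)⁻¹ = (((n : ℝ≥0)⁻¹ : ℝ≥0) : ℝ≥0∞) := by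
          rw [ENNReal.coe_inv hn0]; simp
        rw [this]
        simp only [div_eq_mul_inv, ENNReal.coe_add, ENNReal.coe_mul, ENNReal.coe_one]
        ring

/-- The number of particles with its possible decrease compensated, a submartingale. -/
noncomputable def compensatedCount (S : ParticleSystem d m Ω) (δ : ℝ≥0) (k : ℕ) (ω : Ω) : ℝ≥0 :=
  (S.born k ω).card + δ * ∑ j ∈ Finset.range k, ((S.born j ω).card : ℝ≥0)

theorem measurable_compensatedCount (δ : ℝ≥0) (k : ℕ) :
    Measurable[S.offspringPast k] (S.compensatedCount δ k) := by
  refine Measurable.add (S.measurable_card_born k) (Measurable.const_mul ?_ _)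
  exact Finset.measurable_sum _ fun j hj => (S.measurable_card_born j).mono
    (S.offspringPast_mono (Finset.mem_range.1 hj).le) le_rfl

/-- The lower mean bound is applied label by label to f times the indicator of being born. The
possible loss (g/n) Z_k is exactly the new summand of the compensator. -/
theorem IsBranchingSystem.lintegral_mul_compensatedCount_le
    (hS : S.IsBranchingSystem P n b e c γ σ) (hg : ∀ x, |γ x| ≤ g) (k : ℕ) {f : Ω → ℝ≥0}
    (hf : Measurable[S.offspringPast k] f) :
    ∫⁻ ω, f ω * S.compensatedCount (g / n) k ω ∂P ≤
      ∫⁻ ω, f ω * S.compensatedCount (g / n) (k + 1) ω ∂P := by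
  have hpast := hS.offspringPast_le k
  have hb : ∀ α : Label S.K k, MeasurableSet[S.offspringPast k] {ω | S.IsBorn k α ω} :=
    S.measurableSet_isBorn k
  set F : Label S.K k → Ω → ℝ≥0∞ := fun α => {ω | S.IsBorn k α ω}.indicator fun ω => (f ω : ℝ≥0∞)
    with hF
  have hFm : ∀ α, Measurable[S.offspringPast k] (F α) :=
    fun α => (hf.coe_nnreal_ennreal).indicator (hb α)
  have hFm' : ∀ α, Measurable (F α) := fun α => (hFm α).mono hpast le_rfl
  have e1 : ∀ ω, (f ω : ℝ≥0∞) * (S.born k ω).card = ∑' α, F α ω := by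
    intro ω
    rw [card_born_eq_tsum, ← ENNReal.tsum_mul_left]
    exact tsum_congr fun α => by by_cases h : S.IsBorn k α ω <;> simp [hF, h]
  have e2 : ∀ ω, (f ω : ℝ≥0∞) * (S.born (k + 1) ω).card = ∑' α, F α ω * S.N k α ω := by
    intro ω
    rw [card_born_succ, Nat.cast_sum, sum_born_eq_tsum, ← ENNReal.tsum_mul_left]
    exact tsum_congr fun α => by by_cases h : S.IsBorn k α ω <;> simp [hF, h]
  have hcard : ∀ j, Measurable fun ω => ((S.born j ω).card : ℝ≥0∞) := fun j => by
    simpa using ((S.measurable_card_born j).mono (hS.offspringPast_le j) le_rfl).coe_nnreal_ennreal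
  have hfm : Measurable fun ω => (f ω : ℝ≥0∞) := (hf.mono hpast le_rfl).coe_nnreal_ennreal
  have key : ∫⁻ ω, (f ω : ℝ≥0∞) * (S.born k ω).card ∂P ≤
      ∫⁻ ω, (f ω : ℝ≥0∞) * (S.born (k + 1) ω).card ∂P
        + (g / n : ℝ≥0) * ∫⁻ ω, (f ω : ℝ≥0∞) * (S.born k ω).card ∂P := by
    have hFN : ∀ α, Measurable fun ω => F α ω * S.N k α ω :=
      fun α => (hFm' α).mul (hS.measurable_coe_N k α)
    simp_rw [e1, e2]
    rw [lintegral_tsum fun α => (hFm' α).aemeasurable,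
      lintegral_tsum fun α => (hFN α).aemeasurable,
      ← ENNReal.tsum_mul_left, ← ENNReal.tsum_add]
    exact ENNReal.tsum_le_tsum fun α =>
      hS.lintegral_le_mul_add hg k α ((hFm α).mono (S.offspringPast_le_filtBar n k) le_rfl)
  set R : Ω → ℝ≥0∞ := fun ω => f ω * ((g / n : ℝ≥0) *
    ∑ j ∈ Finset.range k, ((S.born j ω).card : ℝ≥0∞)) with hR
  have hRm : Measurable R :=
    hfm.mul ((Finset.measurable_sum _ fun j _ => hcard j).const_mul _)
  have c1 : ∀ ω, (f ω : ℝ≥0∞) * S.compensatedCount (g / n) k ω =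
      f ω * (S.born k ω).card + R ω := by
    intro ω
    simp only [compensatedCount, hR, ENNReal.coe_add, ENNReal.coe_mul, ENNReal.ofNNReal_finsetSum,
      ENNReal.coe_natCast]
    ring
  have c2 : ∀ ω, (f ω : ℝ≥0∞) * S.compensatedCount (g / n) (k + 1) ω =
      f ω * (S.born (k + 1) ω).card + (g / n : ℝ≥0) * (f ω * (S.born k ω).card) + R ω := by
    intro ω
    simp only [compensatedCount, hR, ENNReal.coe_add, ENNReal.coe_mul, ENNReal.ofNNReal_finsetSum,
      ENNReal.coe_natCast, Finset.sum_range_succ]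
    ring
  simp_rw [c1, c2]
  have hfc : ∀ j, Measurable fun ω => (f ω : ℝ≥0∞) * (S.born j ω).card :=
    fun j => hfm.mul (hcard j)
  rw [lintegral_add_right _ hRm, lintegral_add_right _ hRm,
    lintegral_add_left (hfc (k + 1)), lintegral_const_mul _ (hfc k)]
  gcongr

end ParticleSystem

/-! ### From the recursion to the supremum over time. -/

theorem le_one_add_pow_mul_of_le {u : ℕ → ℝ≥0∞} {A B : ℝ≥0}
    (h : ∀ k, u (k + 1) ≤ (1 + A : ℝ≥0) * u k + B) (k : ℕ) :
    u k ≤ ((1 + A) ^ k : ℝ≥0) * (u 0 + k * B) := by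
  induction k with
  | zero => simp
  | succ k ih =>
    have h1 : (1 : ℝ≥0∞) ≤ ((1 + A) ^ (k + 1) : ℝ≥0) := by
      rw [← ENNReal.coe_one, ENNReal.coe_le_coe]
      exact one_le_pow₀ le_self_add
    calc u (k + 1) ≤ (1 + A : ℝ≥0) * (((1 + A) ^ k : ℝ≥0) * (u 0 + k * B)) + 1 * B := by
          rw [one_mul]; exact (h k).trans (by gcongr)
      _ ≤ (1 + A : ℝ≥0) * (((1 + A) ^ k : ℝ≥0) * (u 0 + k * B))
          + ((1 + A) ^ (k + 1) : ℝ≥0) * B := by gcongr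
      _ = _ := by push_cast; ring

/-- Discrete Gronwall: over k ≤ nT steps the factors multiply to at most exp (a T), and the
increments b n^(p-1) add up to at most T b n^p. -/
theorem le_mul_rpow_of_recursion {u : ℕ → ℝ≥0∞} {a b κ T : ℝ≥0} {p : ℝ} (hp : 1 ≤ p) {n : ℕ}
    (hn : 1 ≤ n)
    (h : ∀ k, u (k + 1) ≤ (1 + a / n : ℝ≥0) * u k + (b * (n : ℝ≥0) ^ (p - 1) : ℝ≥0))
    (h0 : u 0 ≤ ((κ * n) ^ p : ℝ≥0)) {k : ℕ} (hk : (k : ℝ≥0) ≤ n * T) :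
    u k ≤ ((Real.exp (a * T)).toNNReal * (κ ^ p + T * b) * (n : ℝ≥0) ^ p : ℝ≥0) := by
  have hn0 : (n : ℝ≥0) ≠ 0 := by exact_mod_cast (by omega : n ≠ 0)
  have hx : k * (a / n) ≤ a * T := by
    calc k * (a / n) ≤ n * T * (a / n) := by gcongr
      _ = a * T := by field_simp
  have he := (one_add_pow_le_of_mul_le hx).2
  push_cast at he
  refine (le_one_add_pow_mul_of_le h k).trans ?_
  calc _ ≤ (((1 + a / n) ^ k : ℝ≥0) : ℝ≥0∞) *
        (((κ * n) ^ p : ℝ≥0) + (k : ℝ≥0) * (b * (n : ℝ≥0) ^ (p - 1) : ℝ≥0)) := by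
        gcongr; simp
    _ = (((1 + a / n) ^ k * ((κ * n) ^ p + k * (b * (n : ℝ≥0) ^ (p - 1))) : ℝ≥0) : ℝ≥0∞) := by
        simp only [ENNReal.coe_mul, ENNReal.coe_add]
    _ ≤ _ := by
        rw [ENNReal.coe_le_coe]
        calc _ ≤ (Real.exp (a * T)).toNNReal *
              ((κ * n) ^ p + n * T * (b * (n : ℝ≥0) ^ (p - 1))) := by gcongr
          _ = _ := by
            rw [NNReal.mul_rpow, nnreal_rpow_eq_rpow_sub_one_mul hp (n : ℝ≥0)]; ring

theorem nnreal_add_rpow_le_two_rpow_mul {q : ℝ} (hq : 0 ≤ q) (x y : ℝ≥0) :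
    (x + y) ^ q ≤ 2 ^ q * (x ^ q + y ^ q) := by
  rw [← NNReal.coe_le_coe]
  push_cast
  exact add_rpow_le_two_rpow_mul hq x.coe_nonneg y.coe_nonneg

namespace ParticleSystem

variable {d m : ℕ} {Ω : Type*} {S : ParticleSystem d m Ω} {mΩ : MeasurableSpace Ω} {P : Measure Ω}
  {n : ℕ} {b : E d → E d} {e : E d → Matrix (Fin d) (Fin d) ℝ}
  {c : E d → Matrix (Fin d) (Fin m) ℝ} {γ σ : E d → ℝ}

theorem compensatedCount_rpow_le {p : ℝ} (hp : 1 ≤ p) (δ : ℝ≥0) (k : ℕ) (ω : Ω) :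
    S.compensatedCount δ k ω ^ p ≤ 2 ^ p * (((S.born k ω).card : ℝ≥0) ^ p
      + δ ^ p * ((k : ℝ≥0) ^ (p - 1) * ∑ j ∈ Finset.range k, ((S.born j ω).card : ℝ≥0) ^ p)) := by
  refine (nnreal_add_rpow_le_two_rpow_mul (by linarith) _ _).trans ?_
  rw [NNReal.mul_rpow]
  gcongr
  have := NNReal.rpow_sum_le_const_mul_sum_rpow (Finset.range k)
    (fun j => ((S.born j ω).card : ℝ≥0)) hp
  rwa [Finset.card_range] at this

/-- By the power mean inequality the compensator costs (g/n)^p k^p ≤ (g T)^p, so the order n^p is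
preserved. -/
theorem IsBranchingSystem.lintegral_compensatedCount_rpow_le
    (hS : S.IsBranchingSystem P n b e c γ σ) (hn : 1 ≤ n) {p : ℝ} (hp : 1 ≤ p) {g T c₁ : ℝ≥0}
    {k : ℕ} (hk : (k : ℝ≥0) ≤ n * T)
    (hu : ∀ j ≤ k, ∫⁻ ω, ((S.born j ω).card : ℝ≥0∞) ^ p ∂P ≤ (c₁ * (n : ℝ≥0) ^ p : ℝ≥0)) :
    ∫⁻ ω, (S.compensatedCount (g / n) k ω : ℝ≥0∞) ^ p ∂P ≤
      (2 ^ p * c₁ * (1 + (g * T) ^ p) * (n : ℝ≥0) ^ p : ℝ≥0) := by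
  have hp0 : 0 ≤ p := by linarith
  have hn0 : (n : ℝ≥0) ≠ 0 := by exact_mod_cast (by omega : n ≠ 0)
  have hcard : ∀ j, Measurable fun ω => (((S.born j ω).card : ℝ≥0) ^ p : ℝ≥0) := fun j =>
    ((S.measurable_card_born j).mono (hS.offspringPast_le j) le_rfl).pow_const p
  have hcard' : ∀ j, Measurable fun ω => ((((S.born j ω).card : ℝ≥0) ^ p : ℝ≥0) : ℝ≥0∞) :=
    fun j => (hcard j).coe_nnreal_ennreal
  simp_rw [← coe_natCast_rpow hp0] at hu
  calc _ ≤ ∫⁻ ω, ((2 ^ p : ℝ≥0) : ℝ≥0∞) * (((((S.born k ω).card : ℝ≥0) ^ p : ℝ≥0) : ℝ≥0∞)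
      + ((g / n) ^ p * (k : ℝ≥0) ^ (p - 1) : ℝ≥0) *
        ∑ j ∈ Finset.range k, ((((S.born j ω).card : ℝ≥0) ^ p : ℝ≥0) : ℝ≥0∞)) ∂P := by
        refine lintegral_mono fun ω => ?_
        have := ENNReal.coe_le_coe.2 (compensatedCount_rpow_le (S := S) hp (g / n) k ω)
        rw [ENNReal.coe_rpow_of_nonneg _ hp0, ← mul_assoc ((g / n) ^ p), ENNReal.coe_mul,
          ENNReal.coe_add, ENNReal.coe_mul _ (Finset.sum _ _),
          ENNReal.ofNNReal_finsetSum] at this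
        exact this
    _ = ((2 ^ p : ℝ≥0) : ℝ≥0∞) * (∫⁻ ω, ((((S.born k ω).card : ℝ≥0) ^ p : ℝ≥0) : ℝ≥0∞) ∂P
      + ((g / n) ^ p * (k : ℝ≥0) ^ (p - 1) : ℝ≥0) *
        ∑ j ∈ Finset.range k, ∫⁻ ω, ((((S.born j ω).card : ℝ≥0) ^ p : ℝ≥0) : ℝ≥0∞) ∂P) := by
        rw [lintegral_const_mul' _ _ ENNReal.coe_ne_top, lintegral_add_left (hcard' k),
          lintegral_const_mul' _ _ ENNReal.coe_ne_top, lintegral_finsetSum _ fun j _ => hcard' j]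
    _ ≤ ((2 ^ p : ℝ≥0) : ℝ≥0∞) * ((c₁ * (n : ℝ≥0) ^ p : ℝ≥0)
      + ((g / n) ^ p * (k : ℝ≥0) ^ (p - 1) : ℝ≥0) *
        ∑ j ∈ Finset.range k, ((c₁ * (n : ℝ≥0) ^ p : ℝ≥0) : ℝ≥0∞)) := by
        gcongr with j hj
        · exact hu k le_rfl
        · exact hu j (Finset.mem_range.1 hj).le
    _ = (2 ^ p * (c₁ * (n : ℝ≥0) ^ p + (g / n) ^ p * (k : ℝ≥0) ^ p * (c₁ * (n : ℝ≥0) ^ p))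
        : ℝ≥0) := by
        rw [Finset.sum_const, Finset.card_range, nsmul_eq_mul,
          nnreal_rpow_eq_rpow_sub_one_mul hp (k : ℝ≥0)]
        simp only [ENNReal.coe_mul, ENNReal.coe_add, ENNReal.coe_natCast]
        ring
    _ ≤ _ := by
        rw [ENNReal.coe_le_coe]
        have : (g / n) ^ p * (k : ℝ≥0) ^ p ≤ (g * T) ^ p := by
          rw [← NNReal.mul_rpow]
          refine NNReal.rpow_le_rpow ?_ hp0
          calc g / n * k ≤ g / n * (n * T) := by gcongr
            _ = g * T := by field_simp
        calc _ ≤ 2 ^ p * (c₁ * (n : ℝ≥0) ^ p + (g * T) ^ p * (c₁ * (n : ℝ≥0) ^ p)) := by gcongr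
          _ = _ := by ring

variable [IsProbabilityMeasure P]

theorem IsBranchingSystem.lintegral_iSup_X_univ_rpow_le
    (hS : S.IsBranchingSystem P n b e c γ σ) (hn : 1 ≤ n) {p : ℝ} (hp : 2 ≤ p) {g T c₁ : ℝ≥0}
    (hg : ∀ x, |γ x| ≤ g)
    (hu : ∀ k : ℕ, (k : ℝ≥0) ≤ n * T →
      ∫⁻ ω, ((S.born k ω).card : ℝ≥0∞) ^ p ∂P ≤ (c₁ * (n : ℝ≥0) ^ p : ℝ≥0)) :
    ∫⁻ ω, (⨆ (t : ℝ≥0) (_ : t ≤ T), S.X n t ω Set.univ ^ p) ∂P ≤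
      (4 ^ (p + 1) * (2 ^ p * c₁ * (1 + (g * T) ^ p)) : ℝ≥0) := by
  have hp0 : 0 ≤ p := by linarith
  have hn0 : (n : ℝ≥0) ≠ 0 := by exact_mod_cast (by omega : n ≠ 0)
  set k := ⌊(n : ℝ≥0) * T⌋₊ with hk
  have hkT : (k : ℝ≥0) ≤ n * T := Nat.floor_le zero_le
  have hjT : ∀ j ≤ k, (j : ℝ≥0) ≤ n * T := fun j hj => le_trans (by exact_mod_cast hj) hkT
  set L : ℕ → Ω → ℝ≥0 := S.compensatedCount (g / n) with hL
  have hLp : ∀ j ≤ k, ∫⁻ ω, (L j ω : ℝ≥0∞) ^ p ∂P ≤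
      (2 ^ p * c₁ * (1 + (g * T) ^ p) * (n : ℝ≥0) ^ p : ℝ≥0) := fun j hj =>
    hS.lintegral_compensatedCount_rpow_le hn (by linarith) (hjT j hj)
      fun i hi => hu i (hjT i (hi.trans hj))
  have hdoob := lintegral_partialSups_rpow_le (P := P) hp S.offspringPast S.offspringPast_mono
    hS.offspringPast_le L (fun j => S.measurable_compensatedCount _ j)
    (fun j f hf => hS.lintegral_mul_compensatedCount_le hg j hf) k
    fun j hj => ne_top_of_le_ne_top ENNReal.coe_ne_top (hLp j hj)
  -- The mass depends on t only through the generation ⌊nt⌋ ≤ k, so the uncountable supremum is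
  -- dominated by a finite maximum, without any measurability question.
  have hpt : ∀ ω, (⨆ (t : ℝ≥0) (_ : t ≤ T), S.X n t ω Set.univ ^ p) ≤
      (((n : ℝ≥0)⁻¹ ^ p : ℝ≥0) : ℝ≥0∞) * (partialSups (fun j => L j ω) k : ℝ≥0∞) ^ p := by
    intro ω
    refine iSup₂_le fun t ht => ?_
    rw [X_univ, ENNReal.mul_rpow_of_nonneg _ _ hp0, ENNReal.coe_rpow_of_nonneg _ hp0,
      ENNReal.coe_inv hn0, ENNReal.coe_natCast]
    gcongr
    have h1 : ⌊(n : ℝ≥0) * t⌋₊ ≤ k := Nat.floor_le_floor (by gcongr)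
    have h2 := le_partialSups_of_le (fun j => L j ω) h1
    have h3 : ((S.born ⌊(n : ℝ≥0) * t⌋₊ ω).card : ℝ≥0) ≤ L ⌊(n : ℝ≥0) * t⌋₊ ω := le_self_add
    exact_mod_cast ENNReal.coe_le_coe.2 (h3.trans h2)
  calc _ ≤ ∫⁻ ω, (((n : ℝ≥0)⁻¹ ^ p : ℝ≥0) : ℝ≥0∞) *
        (partialSups (fun j => L j ω) k : ℝ≥0∞) ^ p ∂P := lintegral_mono hpt
    _ = (((n : ℝ≥0)⁻¹ ^ p : ℝ≥0) : ℝ≥0∞) *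
        ∫⁻ ω, (partialSups (fun j => L j ω) k : ℝ≥0∞) ^ p ∂P :=
        lintegral_const_mul' _ _ ENNReal.coe_ne_top
    _ ≤ (((n : ℝ≥0)⁻¹ ^ p : ℝ≥0) : ℝ≥0∞) * (4 ^ (p + 1) *
        (2 ^ p * c₁ * (1 + (g * T) ^ p) * (n : ℝ≥0) ^ p : ℝ≥0)) := by
        gcongr
        exact hdoob.trans (by gcongr; exact hLp k le_rfl)
    _ = _ := by
        have h4 : (4 : ℝ≥0∞) ^ (p + 1) = ((4 ^ (p + 1) : ℝ≥0) : ℝ≥0∞) := by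
          rw [ENNReal.coe_rpow_of_nonneg _ (by linarith)]; simp
        rw [h4, ← ENNReal.coe_mul, ← ENNReal.coe_mul, ENNReal.coe_inj]
        have h5 : ((n : ℝ≥0)⁻¹) ^ p * (n : ℝ≥0) ^ p = 1 := by
          rw [← NNReal.mul_rpow, inv_mul_cancel₀ hn0, NNReal.one_rpow]
        calc _ = ((n : ℝ≥0)⁻¹ ^ p * (n : ℝ≥0) ^ p) *
              (4 ^ (p + 1) * (2 ^ p * c₁ * (1 + (g * T) ^ p))) := by ring
          _ = _ := by rw [h5, one_mul]

theorem X₀_mass (S : ParticleSystem d m Ω) (n : ℕ) :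
    (S.X₀ n).mass = (n : ℝ≥0)⁻¹ * S.K := by
  have hadd : ∀ μ ν : FiniteMeasure (E d), (μ + ν).mass = μ.mass + ν.mass := fun μ ν => by
    rw [FiniteMeasure.mass, FiniteMeasure.coeFn_add]; rfl
  have hsmul : ∀ (r : ℝ≥0) (μ : FiniteMeasure (E d)), (r • μ).mass = r * μ.mass := fun r μ => by
    rw [FiniteMeasure.mass, FiniteMeasure.smul_apply, smul_eq_mul]; rfl
  have hsum : ∀ (f : ℕ → FiniteMeasure (E d)) (t : Finset ℕ), (∀ i, (f i).mass = 1) →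
      (∑ i ∈ t, f i).mass = t.card := by
    intro f t hf
    induction t using Finset.induction_on with
    | empty => simp
    | insert i t hi ih =>
      rw [Finset.sum_insert hi, Finset.card_insert_of_notMem hi, hadd, ih, hf]
      push_cast; ring
  let δ : ℕ → FiniteMeasure (E d) := fun i => ⟨Measure.dirac (S.x i), inferInstance⟩
  have hδ : ∀ i, (δ i).mass = 1 := fun i =>
    congrArg ENNReal.toNNReal (measure_univ (μ := Measure.dirac (S.x i)))
  have h : (S.X₀ n).mass = (n : ℝ≥0)⁻¹ * (∑ i ∈ Finset.Icc 1 S.K, δ i).mass := hsmul _ _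
  rw [h, hsum δ _ hδ]
  simp

end ParticleSystem

/-! ### Constants uniform in n and the conclusion. -/

/-- For large n the functions are within 1 of a bounded limit; the finitely many others are bounded
one by one, and their bounds are summed. -/
theorem exists_forall_abs_le {d : ℕ} {f : ℕ → E d → ℝ} {f_lim : E d → ℝ}
    (hf : ∀ n, 1 ≤ n → InCl (f n)) (hlim : InCl f_lim) (h : TendstoUniformly f f_lim atTop) :
    ∃ g : ℝ≥0, ∀ n, 1 ≤ n → ∀ x, |f n x| ≤ g := by
  obtain ⟨-, ⟨M, hM⟩, -⟩ := hlim
  obtain ⟨n₀, hn₀⟩ := eventually_atTop.1 (Metric.tendstoUniformly_iff.1 h 1 one_pos)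
  have hex : ∀ n, ∃ A : ℝ, 1 ≤ n → ∀ x, |f n x| ≤ A := fun n => by
    by_cases hn : 1 ≤ n
    · obtain ⟨-, ⟨A, hA⟩, -⟩ := hf n hn
      exact ⟨A, fun _ => hA⟩
    · exact ⟨0, fun h => absurd h hn⟩
  choose A hA using hex
  refine ⟨(M + 1).toNNReal + ∑ n ∈ Finset.range n₀, (A n).toNNReal, fun n hn x => ?_⟩
  push_cast
  have hsum : 0 ≤ ∑ n ∈ Finset.range n₀, ((A n).toNNReal : ℝ) :=
    Finset.sum_nonneg fun _ _ => NNReal.coe_nonneg _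
  have hM' := Real.le_coe_toNNReal (M + 1)
  rcases le_or_gt n₀ n with h0 | h0
  · have h1 := hn₀ n h0 x
    rw [Real.dist_eq, abs_sub_comm] at h1
    have h2 := abs_sub_abs_le_abs_sub (f n x) (f_lim x)
    linarith [hM x]
  · have h1 := Finset.single_le_sum (f := fun n => ((A n).toNNReal : ℝ))
      (fun _ _ => NNReal.coe_nonneg _) (Finset.mem_range.2 h0)
    have h2 := Real.le_coe_toNNReal (A n)
    have h3 := hA n hn x
    have h4 : (0 : ℝ) ≤ (M + 1).toNNReal := NNReal.coe_nonneg _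
    linarith

theorem exists_forall_lintegral_iSup_X_le {d m : ℕ} {b : E d → E d}
    {e : E d → Matrix (Fin d) (Fin d) ℝ} {c : E d → Matrix (Fin d) (Fin m) ℝ}
    {γ σ : ℕ → E d → ℝ} {Ω : ℕ → Type*} [∀ n, MeasurableSpace (Ω n)]
    {P : ∀ n, Measure (Ω n)} [∀ n, IsProbabilityMeasure (P n)]
    {S : ∀ n, ParticleSystem d m (Ω n)}
    (hS : ∀ n, 1 ≤ n → (S n).IsBranchingSystem (P n) n b e c (γ n) (σ n))
    {g s κ : ℝ≥0} (hg : ∀ n, 1 ≤ n → ∀ x, |γ n x| ≤ g) (hs : ∀ n, 1 ≤ n → ∀ x, |σ n x| ≤ s)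
    (hκ : ∀ n, 1 ≤ n → ((S n).K : ℝ≥0) ≤ κ * n) {p : ℝ} (hp : 2 ≤ p) (C : ℝ≥0)
    (hC : ∀ n, 1 ≤ n → ∀ k α,
      ∫⁻ ω in {ω | (S n).IsBorn k α ω}, ((S n).N k α ω : ℝ≥0∞) ^ p ∂(P n) ≤
        C * P n {ω | (S n).IsBorn k α ω})
    (T : ℝ≥0) :
    (⨆ (n : ℕ) (_ : 1 ≤ n),
      ∫⁻ ω, (⨆ (t : ℝ≥0) (_ : t ≤ T), (S n).X n t ω Set.univ ^ p) ∂(P n)) < ⊤ := by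
  obtain ⟨c₂, hc⟩ := exists_add_rpow_le hp
  have hp0 : 0 ≤ p := by linarith
  set v : ℝ≥0 := s ^ 2 + (1 + g) ^ 2 with hv
  set D : ℝ≥0 := (Real.exp (p.toNNReal * g + c₂ * v)).toNNReal with hD
  set A : ℝ≥0 := 2 * D * (p.toNNReal * g + c₂ * v) + D * c₂ * C
  set B : ℝ≥0 := 2 * D * (c₂ * v) + D * c₂ * C
  set c₁ : ℝ≥0 := (Real.exp (A * T)).toNNReal * (κ ^ p + T * B)
  refine lt_of_le_of_lt (b := ((4 ^ (p + 1) * (2 ^ p * c₁ * (1 + (g * T) ^ p)) : ℝ≥0) : ℝ≥0∞))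
    (iSup₂_le fun n hn => ?_) ENNReal.coe_lt_top
  refine (hS n hn).lintegral_iSup_X_univ_rpow_le hn hp (hg n hn) fun k hk => ?_
  refine le_mul_rpow_of_recursion (p := p) (by linarith) hn
    (u := fun k => ∫⁻ ω, (((S n).born k ω).card : ℝ≥0∞) ^ p ∂(P n))
    (fun k => (hS n hn).lintegral_card_born_succ_le hn (hg n hn) (hs n hn) hp hv hD hc
      (hC n hn k)) ?_ hk
  calc _ ≤ ∫⁻ _, ((((κ * n) ^ p : ℝ≥0)) : ℝ≥0∞) ∂(P n) := by
        refine lintegral_mono fun ω => ?_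
        rw [← ParticleSystem.coe_natCast_rpow hp0, ENNReal.coe_le_coe]
        refine NNReal.rpow_le_rpow (le_trans ?_ (hκ n hn)) hp0
        exact_mod_cast (S n).card_born_zero_le ω
    _ = _ := by simp

end FlowBranching

theorem lemma2p1 {d m : ℕ}
    -- coefficients of the motion
    (b : E d → E d) (e : E d → Matrix (Fin d) (Fin d) ℝ) (c : E d → Matrix (Fin d) (Fin m) ℝ)
    (hb : Measurable b) (he : ∀ i j, Measurable fun x => e x i j)
    (hc : ∀ i l, Measurable fun x => c x i l)
    -- branching parameters
    (γ σ : ℕ → E d → ℝ) (γ_lim σ_lim : E d → ℝ)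
    (hγ : ∀ n, 1 ≤ n → InCl (γ n)) (hσ : ∀ n, 1 ≤ n → InCl (σ n) ∧ ∀ x, 0 ≤ σ n x)
    (hγ_lim : InCl γ_lim) (hσ_lim : InCl σ_lim ∧ ∀ x, 0 ≤ σ_lim x)
    (hγ_unif : TendstoUniformly γ γ_lim atTop) (hσ_unif : TendstoUniformly σ σ_lim atTop)
    -- the particle systems
    {Ω : ℕ → Type*} [∀ n, MeasurableSpace (Ω n)]
    (P : ∀ n, Measure (Ω n)) [∀ n, IsProbabilityMeasure (P n)]
    (S : ∀ n, ParticleSystem d m (Ω n))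
    (hS : ∀ n, 1 ≤ n → (S n).IsBranchingSystem (P n) n b e c (γ n) (σ n))
    -- moment assumption
    (p : ℝ) (hp : 2 < p) (C : ℝ≥0)
    (hN : ∀ n, 1 ≤ n → ∀ k α, ∫⁻ ω, ((S n).N k α ω : ℝ≥0∞) ^ p ∂(P n) ≤ C)
    -- convergence of the initial measures
    (ν : FiniteMeasure (E d)) (hν : Tendsto (fun n => (S n).X₀ n) atTop (𝓝 ν))
    (T : ℝ≥0) :
    (⨆ (n : ℕ) (_ : 1 ≤ n),
      ∫⁻ ω, (⨆ (t : ℝ≥0) (_ : t ≤ T), (S n).X n t ω Set.univ ^ 2) ∂(P n)) < ⊤ ∧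
    -- for the exponent `p` the moment assumption is read for the particles that are born
    ((∀ n, 1 ≤ n → ∀ k α, ∫⁻ ω in {ω | (S n).IsBorn k α ω}, ((S n).N k α ω : ℝ≥0∞) ^ p ∂(P n) ≤
        C * P n {ω | (S n).IsBorn k α ω}) →
      (⨆ (n : ℕ) (_ : 1 ≤ n),
        ∫⁻ ω, (⨆ (t : ℝ≥0) (_ : t ≤ T), (S n).X n t ω Set.univ ^ p) ∂(P n)) < ⊤) := by
  obtain ⟨g, hg⟩ := exists_forall_abs_le hγ hγ_lim hγ_unif
  obtain ⟨s, hs⟩ := exists_forall_abs_le (fun n hn => (hσ n hn).1) hσ_lim.1 hσ_unif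
  -- Weak convergence implies convergence of the initial masses K_n / n, and a convergent sequence
  -- is bounded.
  obtain ⟨κ, hκ⟩ : ∃ κ : ℝ≥0, ∀ n, 1 ≤ n → ((S n).K : ℝ≥0) ≤ κ * n := by
    obtain ⟨κ, hκ⟩ := ((FiniteMeasure.continuous_mass.tendsto ν).comp hν).bddAbove_range
    refine ⟨κ, fun n hn => ?_⟩
    have h := hκ ⟨n, rfl⟩
    have hn0 : (0 : ℝ≥0) < n := by exact_mod_cast hn
    rw [Function.comp_apply, ParticleSystem.X₀_mass, inv_mul_le_iff₀ hn0, mul_comm] at h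
    exact h
  refine ⟨?_, fun hC => exists_forall_lintegral_iSup_X_le hS hg hs hκ hp.le C hC T⟩
  -- For exponent 2 the constant is the bound on the conditional second moment, tested against the
  -- indicator of being born.
  have h2 := exists_forall_lintegral_iSup_X_le hS hg hs hκ le_rfl (s ^ 2 + (1 + g) ^ 2)
    (fun n hn k α => ?_) T
  · simpa only [ENNReal.rpow_two] using h2
  · have hb := (S n).measurableSet_isBorn k α
    have h := (hS n hn).lintegral_mul_sq_le hn (hg n hn) (hs n hn) k α
      (f := {ω | (S n).IsBorn k α ω}.indicator fun _ => 1)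
      ((@measurable_const _ _ _ ((S n).filtBar n k) 1).indicator
        ((S n).offspringPast_le_filtBar n k _ hb))
    have hb' := (hS n hn).offspringPast_le k _ hb
    rw [lintegral_indicator_const hb', one_mul] at h
    refine le_trans (le_of_eq ?_) h
    rw [← lintegral_indicator hb']
    refine lintegral_congr fun ω => ?_
    by_cases hω : (S n).IsBorn k α ω <;> simp [hω]
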